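/- **Conventions.** For $z_0=(x_0,t_0)\in\mathbb R^2$ and $R>0$ let $Q_R(z_0)=(x_0-R,x_0+R)\times(t_0-R^4,t_0]$, and let $L_{p,q}(Q_R(z_0))=L_q(t_0-R^4,t_0;L_p(x_0-R,x_0+R))$. Subscripts $x$ denote weak spatial derivatives. $C_0^\infty(Q_R(z_0))$ denotes the restrictions to $Q_R(z_0)$ of functions in $C_0^\infty((x_0-R,x_0+R)\times(t_0-R^4,\infty))$. A function $v$ is a *suitable weak solution* of the surface growth model $v_t+v_{xxxx}=-\partial_{xx}(v_x)^2$ on $Q_R(z_0)$ if - $v\in L_{2,\infty}(Q_R(z_0))$ and $v_{xx}\in L_{2,2}(Q_R(z_0))$; - $\iint \big(v(\phi_t-\phi_{xxxx})-v_x^2\phi_{xx}\big)=0$ for every $\phi\in C_0^\infty((x_0-R,x_0+R)\times(t_0-R^4,t_0))$; - for every nonnegative $\phi\in C_0^\infty(Q_R(z_0))$ and almost every $t\in(t_0-R^4,t_0)$, $$\frac12\int_{x_0-R}^{x_0+R} v^2(t)\phi(t)+\int_{t_0-R^4}^t\int_{x_0-R}^{x_0+R}|v_{xx}|^2\phi\le\int_{t_0-R^4}^t\int_{x_0-R}^{x_0+R}\Big(\tfrac12(\phi_t-\phi_{xxxx})v^2+2v_x^2\phi_{xx}-\tfrac53v_x^3\phi_x-v_x^2v\,\phi_{xx}\Big).$$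 **Cut-offs.** Fix a nonnegative even $\varphi_0\in C_0^\infty(-1,1)$ with $\varphi_0=1$ on $(-1/2,1/2)$, and a nonnegative $\chi_0\in C^\infty(\mathbb R)$ with $\chi_0(t)=0$ for $t\le-1$ and $\chi_0(t)=1$ for $t\ge-1/16$. Put $\varphi_{x_0,R}(x)=\varphi_0((x-x_0)/R)$, $\eta_{z_0,R}(x,t)=\chi_0((t-t_0)/R^4)\,\varphi_{x_0,R}(x)$, and $$\hat v(x,t)=v(x,t)-\Big(\int_{x_0-R}^{x_0+R}\varphi_{x_0,R}\Big)^{-1}\int_{x_0-R}^{x_0+R}v(y,t)\,\varphi_{x_0,R}(y)\,dy .$$ **Proposition (Caccioppoli inequality).** There is a constant $C>0$, depending only on $\varphi_0$ and $\chi_0$, such that for every $z_0=(x_0,t_0)\in\mathbb R^2$, every $R>0$ and every suitable weak solution $v$ on $Q_R(z_0)$, the weak derivatives $\hat v_x,\hat v_{xx}$ exist on $Q_R(z_0)$ and $$\sup_{t\in(t_0-R^4,t_0)}\int_{x_0-R}^{x_0+R}|\hat v(x,t)|^2\eta_{z_0,R}(x,t)\,dx+\int_{Q_R(z_0)}|\hat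 v_{xx}|^2\eta_{z_0,R}\le\frac C{R^2}\int_{Q_R(z_0)}|\hat v_x|^2+\frac CR\int_{Q_R(z_0)}|\hat v_x|^3 .$$ Here the supremum is the essential supremum; it may be replaced by the supremum over every $t\in(t_0-R^4,t_0)$ if $v$ is weakly continuous in time, that is, if $v(t)\in L_2(x_0-R,x_0+R)$ for every $t\in(t_0-R^4,t_0)$ and $t\mapsto\int_{x_0-R}^{x_0+R}v(t)w$ is continuous on $(t_0-R^4,t_0)$ for every $w\in L_2(x_0-R,x_0+R)$. -/

import Mathlib

open MeasureTheory Set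
open scoped ENNReal ContDiff

noncomputable section

namespace SGM

/-- The spatial interval `(x₀ - R, x₀ + R)`, where `z = (x₀, t₀)`. -/
def spaceI (z : ℝ × ℝ) (R : ℝ) : Set ℝ := Ioo (z.1 - R) (z.1 + R)

/-- The open time interval `(t₀ - R⁴, t₀)`, where `z = (x₀, t₀)`. -/
def timeI (z : ℝ × ℝ) (R : ℝ) : Set ℝ := Ioo (z.2 - R ^ 4) z.2

/-- The biparabolic cylinder `Q_R(z) = (x₀ - R, x₀ + R) × (t₀ - R⁴, t₀]`. -/
def cyl (z : ℝ × ℝ) (R : ℝ) : Set (ℝ × ℝ) := spaceI z R ×ˢ Ioc (z.2 - R ^ 4) z.2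

/-- The interior `(x₀ - R, x₀ + R) × (t₀ - R⁴, t₀)` of the cylinder. -/
def openCyl (z : ℝ × ℝ) (R : ℝ) : Set (ℝ × ℝ) := spaceI z R ×ˢ timeI z R

/-- The `k`-th partial derivative in the space variable (first coordinate). -/
def dx (k : ℕ) (φ : ℝ × ℝ → ℝ) (p : ℝ × ℝ) : ℝ :=
  iteratedDeriv k (fun x => φ (x, p.2)) p.1

/-- The partial derivative in the time variable (second coordinate). -/
def dt (φ : ℝ × ℝ → ℝ) (p : ℝ × ℝ) : ℝ :=
  deriv (fun s => φ (p.1, s)) p.2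

/-- `φ` is smooth on the plane with compact support contained in `U`. -/
def IsTest (U : Set (ℝ × ℝ)) (φ : ℝ × ℝ → ℝ) : Prop :=
  ContDiff ℝ ∞ φ ∧ HasCompactSupport φ ∧ tsupport φ ⊆ U

/-- Test functions of the class `C₀^∞(Q_R(z))`: they vanish near the parabolic boundary of the
cylinder, but not necessarily at the final time `t₀`. They are given by smooth functions on the
plane, compactly supported in `(x₀ - R, x₀ + R) × (t₀ - R⁴, ∞)`, of which only the restriction to
the cylinder is ever used. -/
def IsCylTest (z : ℝ × ℝ) (R : ℝ) (φ : ℝ × ℝ → ℝ) : Prop :=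
  IsTest (spaceI z R ×ˢ Ioi (z.2 - R ^ 4)) φ

/-- `g` is the weak (distributional) `k`-th spatial derivative of `f` on `Q_R(z)`. -/
def HasWeakDx (k : ℕ) (z : ℝ × ℝ) (R : ℝ) (f g : ℝ × ℝ → ℝ) : Prop :=
  LocallyIntegrableOn f (openCyl z R) ∧ LocallyIntegrableOn g (openCyl z R) ∧
    ∀ φ : ℝ × ℝ → ℝ, IsTest (openCyl z R) φ →
      ∫ p in openCyl z R, f p * dx k φ p = (-1) ^ k * ∫ p in openCyl z R, g p * φ p

/-- Membership in `L_{p,q}(Q_R(z)) = L_q(t₀ - R⁴, t₀; L_p(x₀ - R, x₀ + R))`. -/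
def MemLpq (p q : ℝ≥0∞) (z : ℝ × ℝ) (R : ℝ) (f : ℝ × ℝ → ℝ) : Prop :=
  AEStronglyMeasurable f (volume.restrict (openCyl z R)) ∧
    eLpNorm (fun t => eLpNorm (fun x => f (x, t)) p (volume.restrict (spaceI z R))) q
      (volume.restrict (timeI z R)) < ⊤

/-- `v` is a suitable weak solution of `v_t + v_xxxx = -∂_xx (v_x)²` on `Q_R(z)`. The functions
`vx`, `vxx` are the weak spatial derivatives of `v`, which are unique up to null sets. -/
def IsSuitableWeakSolution (z : ℝ × ℝ) (R : ℝ) (v : ℝ × ℝ → ℝ) : Prop :=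
  ∃ vx vxx : ℝ × ℝ → ℝ,
    HasWeakDx 1 z R v vx ∧ HasWeakDx 2 z R v vxx ∧
    -- energy class
    MemLpq 2 ⊤ z R v ∧ MemLpq 2 2 z R vxx ∧
    -- the equation in the sense of distributions
    (∀ φ : ℝ × ℝ → ℝ, IsTest (openCyl z R) φ →
      ∫ p in openCyl z R, (v p * (dt φ p - dx 4 φ p) - vx p ^ 2 * dx 2 φ p) = 0) ∧
    -- the local energy inequality
    (∀ φ : ℝ × ℝ → ℝ, IsCylTest z R φ → (∀ p ∈ cyl z R, 0 ≤ φ p) →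
      ∀ᵐ t ∂(volume.restrict (timeI z R)),
        1 / 2 * (∫ x in spaceI z R, v (x, t) ^ 2 * φ (x, t)) +
            (∫ p in spaceI z R ×ˢ Ioo (z.2 - R ^ 4) t, vxx p ^ 2 * φ p) ≤
          ∫ p in spaceI z R ×ˢ Ioo (z.2 - R ^ 4) t,
            (1 / 2 * (dt φ p - dx 4 φ p) * v p ^ 2 + 2 * vx p ^ 2 * dx 2 φ p
              - 5 / 3 * vx p ^ 3 * dx 1 φ p - vx p ^ 2 * v p * dx 2 φ p))

/-- `t ↦ v(t)` is weakly continuous with values in `L₂(x₀ - R, x₀ + R)`. -/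
def IsWeaklyContinuous (z : ℝ × ℝ) (R : ℝ) (v : ℝ × ℝ → ℝ) : Prop :=
  (∀ t ∈ timeI z R, MemLp (fun x => v (x, t)) 2 (volume.restrict (spaceI z R))) ∧
    ∀ w : ℝ → ℝ, MemLp w 2 (volume.restrict (spaceI z R)) →
      ContinuousOn (fun t => ∫ x in spaceI z R, v (x, t) * w x) (timeI z R)

/-- Admissible spatial cut-off `φ₀`. -/
def IsSpaceCutoff (φ₀ : ℝ → ℝ) : Prop :=
  ContDiff ℝ ∞ φ₀ ∧ HasCompactSupport φ₀ ∧ tsupport φ₀ ⊆ Ioo (-1) 1 ∧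
    (∀ x, 0 ≤ φ₀ x) ∧ (∀ x, φ₀ (-x) = φ₀ x) ∧ ∀ x ∈ Ioo (-(1 / 2) : ℝ) (1 / 2), φ₀ x = 1

/-- Admissible temporal cut-off `χ₀`. -/
def IsTimeCutoff (χ₀ : ℝ → ℝ) : Prop :=
  ContDiff ℝ ∞ χ₀ ∧ (∀ t, 0 ≤ χ₀ t) ∧ (∀ t, t ≤ -1 → χ₀ t = 0) ∧ ∀ t, -(1 / 16) ≤ t → χ₀ t = 1

/-- The rescaled spatial cut-off `φ_{x₀,R}(x) = φ₀((x - x₀)/R)`. -/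
def spaceCut (φ₀ : ℝ → ℝ) (z : ℝ × ℝ) (R x : ℝ) : ℝ := φ₀ ((x - z.1) / R)

/-- The rescaled temporal cut-off `χ_{t₀,R}(t) = χ₀((t - t₀)/R⁴)`. -/
def timeCut (χ₀ : ℝ → ℝ) (z : ℝ × ℝ) (R t : ℝ) : ℝ := χ₀ ((t - z.2) / R ^ 4)

/-- The space-time cut-off `η_{z,R}(x,t) = χ_{t₀,R}(t) φ_{x₀,R}(x)`. -/
def eta (φ₀ χ₀ : ℝ → ℝ) (z : ℝ × ℝ) (R : ℝ) (p : ℝ × ℝ) : ℝ :=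
  timeCut χ₀ z R p.2 * spaceCut φ₀ z R p.1

/-- The `φ₀`-related mean `⟨f⟩_{x₀,R}` of a function of the space variable. -/
def wmean (φ₀ : ℝ → ℝ) (z : ℝ × ℝ) (R : ℝ) (f : ℝ → ℝ) : ℝ :=
  (∫ x in spaceI z R, f x * spaceCut φ₀ z R x) * (∫ x in spaceI z R, spaceCut φ₀ z R x)⁻¹

/-- The oscillation `f̂(x,t) = f(x,t) - ⟨f(t)⟩_{x₀,R}`. -/
def hat (φ₀ : ℝ → ℝ) (z : ℝ × ℝ) (R : ℝ) (f : ℝ × ℝ → ℝ) (p : ℝ × ℝ) : ℝ :=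
  f p - wmean φ₀ z R (fun x => f (x, p.2))

end SGM

end

namespace SGM

/-! The local energy inequality survives the replacement of `v` by `v - m(t)`, where `m` is the mean
of `v` with weight `a`, provided the same `a` is the spatial factor of the test function `θ(t) a(x)`
(`ae_hat_energy_le`). Put `Φ = ∫ a`. On a time slice `∫ v² a = ∫ (v - m)² a + m² Φ`. Testing the
equation with `θ a` shows that `M = m Φ` has the integrable weak derivative `-∫ v a'''' - ∫ v_x²
a''` (`integral_mean_mul_deriv`), so `M` is a.e. absolutely continuous and `θ M²` obeys an exact
balance (`ae_mul_sq_eq_integral`). This balance is precisely what the mean contributes to the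
right-hand side, and it cancels the term `m² Φ` on the left.

The remaining right-hand side contains the mean only through `v - m`, and pointwise a.e. `|v - m| ≤
∫ |v_x|` over the slice (`ae_abs_sub_mean_le`). Cauchy-Schwarz for the quadratic term and a
Young-type bound for `v_x² |v - m|`, together with the scaling of the cut-offs, leave only `R⁻² ∫
v_x²` and `R⁻¹ ∫ |v_x|³` (`abs_energy_integral_le`).

The cut-off `χ₀` need not have support away from the initial time, so the estimate is first proved
for time cut-offs shifted by `ε`. The limit uses Fatou's lemma for the second derivative, plain
convergence for almost every slice, and weak lower semicontinuity for every slice when `v` is weakly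
continuous. -/

/-! ### Slices and spatial primitives of test functions -/

lemma hasDerivAt_slice {φ : ℝ × ℝ → ℝ} (hφ : ContDiff ℝ ∞ φ) (p : ℝ × ℝ) :
    HasDerivAt (fun x => φ (x, p.2)) (fderiv ℝ φ p (1, 0)) p.1 := by
  have h1 : HasFDerivAt φ (fderiv ℝ φ p) (p.1, p.2) :=
    (hφ.differentiable (by simp) p).hasFDerivAt
  have h2 : HasDerivAt (fun x : ℝ => (x, p.2)) ((1 : ℝ), (0 : ℝ)) p.1 :=
    (hasDerivAt_id p.1).prodMk (hasDerivAt_const p.1 p.2)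
  exact h1.comp_hasDerivAt p.1 h2

lemma dx_one_eq {φ : ℝ × ℝ → ℝ} (hφ : ContDiff ℝ ∞ φ) :
    dx 1 φ = fun p => fderiv ℝ φ p (1, 0) := by
  ext p
  simp only [dx, iteratedDeriv_one]
  exact (hasDerivAt_slice hφ p).deriv

lemma dx_zero (φ : ℝ × ℝ → ℝ) : dx 0 φ = φ := by
  ext p; simp [dx]

lemma dx_succ (k : ℕ) (φ : ℝ × ℝ → ℝ) : dx (k + 1) φ = dx 1 (dx k φ) := by
  ext p
  simp [dx, iteratedDeriv_succ]

lemma IsTest.dx {U : Set (ℝ × ℝ)} {φ : ℝ × ℝ → ℝ} (h : IsTest U φ) (k : ℕ) :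
    IsTest U (dx k φ) := by
  induction k with
  | zero => rwa [dx_zero]
  | succ k ih =>
    rw [dx_succ, dx_one_eq ih.1]
    have hs : Function.support (fun p => fderiv ℝ (SGM.dx k φ) p (1, 0)) ⊆
        tsupport (SGM.dx k φ) := by
      intro p hp
      by_contra hp'
      apply hp
      have := notMem_subset (tsupport_fderiv_subset ℝ (f := SGM.dx k φ)) hp'
      simp [image_eq_zero_of_notMem_tsupport this]
    refine ⟨(ih.1.fderiv_right (m := ∞) (by simp)).clm_apply contDiff_const,
      HasCompactSupport.of_support_subset_isCompact ih.2.1 hs,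
      (closure_minimal hs (isClosed_tsupport _)).trans ih.2.2⟩

lemma hasCompactSupport_slice {φ : ℝ × ℝ → ℝ} (h : HasCompactSupport φ) (t : ℝ) :
    HasCompactSupport (fun x => φ (x, t)) := by
  refine HasCompactSupport.of_support_subset_isCompact (h.image continuous_fst) ?_
  intro x hx
  exact ⟨(x, t), subset_tsupport _ hx, rfl⟩

/-- Fundamental theorem of calculus on a line. It is the reason why functions of time alone are
invisible to weak space derivatives. -/
lemma IsTest.integral_dx_succ_slice {U : Set (ℝ × ℝ)} {φ : ℝ × ℝ → ℝ} (h : IsTest U φ) (k : ℕ)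
    (t : ℝ) : ∫ x, SGM.dx (k + 1) φ (x, t) = 0 := by
  have hk := h.dx k
  have hk1 := h.dx (k + 1)
  refine integral_eq_zero_of_hasDerivAt_of_integrable (f := fun x => SGM.dx k φ (x, t)) ?_ ?_ ?_
  · intro x
    rw [dx_succ, dx_one_eq hk.1]
    exact hasDerivAt_slice hk.1 (x, t)
  · exact (hk1.1.continuous.comp (by fun_prop)).integrable_of_hasCompactSupport
      (hasCompactSupport_slice hk1.2.1 t)
  · exact (hk.1.continuous.comp (by fun_prop)).integrable_of_hasCompactSupport
      (hasCompactSupport_slice hk.2.1 t)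

lemma exists_Icc_of_isCompact {K : Set ℝ} {α β : ℝ} (hαβ : α < β) (hK : IsCompact K)
    (h : K ⊆ Ioo α β) : ∃ a b, α < a ∧ b < β ∧ K ⊆ Icc a b := by
  rcases K.eq_empty_or_nonempty with rfl | hne
  · exact ⟨(α + β) / 2, (α + β) / 2, by linarith, by linarith, by simp⟩
  · obtain ⟨a, ha⟩ := hK.exists_isLeast hne
    obtain ⟨b, hb⟩ := hK.exists_isGreatest hne
    exact ⟨a, b, (h ha.1).1, (h hb.1).2, fun x hx => ⟨ha.2 hx, hb.2 hx⟩⟩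

/-- Primitives in the space variable of smooth functions with compact support are smooth. -/
lemma contDiff_primitive {ψ : ℝ × ℝ → ℝ} (hψ : ContDiff ℝ ∞ ψ) (hc : HasCompactSupport ψ) {α : ℝ}
    (hα : ∀ p : ℝ × ℝ, p.1 ≤ α → ψ p = 0) :
    ContDiff ℝ ∞ (fun p : ℝ × ℝ => ∫ y in α..p.1, ψ (y, p.2)) := by
  -- The primitive is the convolution of the slice `ψ(·, t)` with the Heaviside function; joint
  -- smoothness then follows from smoothness of convolutions depending on a parameter.
  have key : ContDiffOn ℝ ∞ (fun q : ℝ × ℝ =>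
      (MeasureTheory.convolution ((Ici (0 : ℝ)).indicator (fun _ => (1 : ℝ)))
        (fun y => ψ (y, q.1)) (ContinuousLinearMap.mul ℝ ℝ) volume) q.2)
      ((univ : Set ℝ) ×ˢ univ) := by
    refine contDiffOn_convolution_right_with_param (n := ⊤) (ContinuousLinearMap.mul ℝ ℝ)
      (g := fun t y => ψ (y, t)) isOpen_univ (hc.image continuous_fst) ?_ ?_ ?_
    · intro t x _ hx
      by_contra h0
      exact hx ⟨(x, t), subset_tsupport _ h0, rfl⟩
    · exact (locallyIntegrable_const (1 : ℝ)).indicator measurableSet_Ici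
    · apply ContDiff.contDiffOn
      exact hψ.comp (contDiff_snd.prodMk contDiff_fst)
  rw [univ_prod_univ, contDiffOn_univ] at key
  have h2 := key.comp (contDiff_snd.prodMk contDiff_fst : ContDiff ℝ ∞ (fun p : ℝ × ℝ => (p.2, p.1)))
  convert h2 using 1
  ext ⟨x, t⟩
  simp only [Function.comp]
  rw [convolution_eq_swap]
  have hI : Integrable (fun y => ψ (y, t)) :=
    (hψ.continuous.comp (by fun_prop)).integrable_of_hasCompactSupport
      (hasCompactSupport_slice hc t)
  have e1 : (fun y => (ContinuousLinearMap.mul ℝ ℝ) ((Ici (0 : ℝ)).indicator (fun _ => (1 : ℝ))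
      (x - y)) (ψ (y, t))) = (Iic x).indicator (fun y => ψ (y, t)) := by
    ext y
    by_cases hy : y ≤ x <;> simp [indicator, hy]
  rw [e1, integral_indicator measurableSet_Iic]
  have e2 : ∫ y in Iic α, ψ (y, t) = 0 :=
    setIntegral_eq_zero_of_forall_eq_zero fun y hy => hα (y, t) hy
  rw [← intervalIntegral.integral_Iic_sub_Iic hI.integrableOn hI.integrableOn, e2, sub_zero]

/-- The test function whose space derivative is `ψ` corrected to have mean zero on slices. -/
lemma exists_test_primitive {α β : ℝ} (hαβ : α < β) {J : Set ℝ} {ρ : ℝ → ℝ}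
    (hρ : ContDiff ℝ ∞ ρ) (hρc : HasCompactSupport ρ) (hρs : tsupport ρ ⊆ Ioo α β)
    (hρ1 : ∫ x, ρ x = 1) {ψ : ℝ × ℝ → ℝ} (hψ : IsTest (Ioo α β ×ˢ J) ψ) :
    IsTest (Ioo α β ×ˢ J)
        (fun p => (∫ y in α..p.1, ψ (y, p.2)) - (∫ y in α..p.1, ρ y) * ∫ y, ψ (y, p.2)) ∧
      ∀ p, dx 1 (fun p => (∫ y in α..p.1, ψ (y, p.2)) - (∫ y in α..p.1, ρ y) * ∫ y, ψ (y, p.2)) p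
        = ψ p - ρ p.1 * ∫ y, ψ (y, p.2) := by
  obtain ⟨a, b, ha, hb, hK⟩ := exists_Icc_of_isCompact (K := Prod.fst '' tsupport ψ ∪ tsupport ρ)
    hαβ ((hψ.2.1.image continuous_fst).union hρc) (by
      rintro x (⟨p, hp, rfl⟩ | hx)
      · exact (hψ.2.2 hp).1
      · exact hρs hx)
  have hψ0 : ∀ p : ℝ × ℝ, p.1 ∉ Icc a b → ψ p = 0 := by
    intro p hp
    by_contra h0
    exact hp (hK (Or.inl ⟨p, subset_tsupport _ h0, rfl⟩))
  have hρ0 : ∀ x, x ∉ Icc a b → ρ x = 0 := by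
    intro x hx
    by_contra h0
    exact hx (hK (Or.inr (subset_tsupport _ h0)))
  have hI : ∀ t, Integrable (fun y => ψ (y, t)) := fun t =>
    (hψ.1.continuous.comp (by fun_prop)).integrable_of_hasCompactSupport
      (hasCompactSupport_slice hψ.2.1 t)
  have full : ∀ (u : ℝ → ℝ), (∀ x, x ∉ Icc a b → u x = 0) → ∀ x, b < x →
      ∫ y in α..x, u y = ∫ y, u y := by
    intro u hu x hx
    refine intervalIntegral.integral_eq_integral_of_support_subset ?_
    intro y hy
    have : y ∈ Icc a b := by
      by_contra h
      exact hy (hu y h)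
    exact ⟨by linarith [this.1], by linarith [this.2]⟩
  have zero : ∀ (u : ℝ → ℝ), (∀ x, x ∉ Icc a b → u x = 0) → ∀ x, x < a →
      ∫ y in α..x, u y = 0 := by
    intro u hu x hx
    rw [intervalIntegral.integral_congr (g := fun _ => (0 : ℝ)), intervalIntegral.integral_zero]
    intro y hy
    refine hu y fun h => ?_
    have := hy.2
    rcases le_max_iff.1 this with h' | h' <;> linarith [h.1]
  have cψ := contDiff_primitive hψ.1 hψ.2.1 (α := α) (fun p hp => hψ0 p (by
    intro h; linarith [h.1]))
  have cP : ContDiff ℝ ∞ (fun x => ∫ y in α..x, ρ y) := by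
    have hd : ∀ x, HasDerivAt (fun x => ∫ y in α..x, ρ y) (ρ x) x := fun x =>
      intervalIntegral.integral_hasDerivAt_right (hρ.continuous.intervalIntegrable _ _)
        hρ.continuous.aestronglyMeasurable.stronglyMeasurableAtFilter hρ.continuous.continuousAt
    rw [contDiff_infty_iff_deriv]
    refine ⟨fun x => (hd x).differentiableAt, ?_⟩
    rw [funext fun x => (hd x).deriv]
    exact hρ
  have eS : (fun p : ℝ × ℝ => ∫ y, ψ (y, p.2)) = fun p : ℝ × ℝ => ∫ y in α..β, ψ (y, p.2) := by
    ext p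
    exact (full _ (fun x hx => hψ0 (x, p.2) hx) β hb).symm
  have cS : ContDiff ℝ ∞ (fun p : ℝ × ℝ => ∫ y, ψ (y, p.2)) := by
    rw [eS]
    exact cψ.comp (contDiff_const.prodMk contDiff_snd : ContDiff ℝ ∞ (fun p : ℝ × ℝ => (β, p.2)))
  have hsupp : Function.support (fun p : ℝ × ℝ =>
      (∫ y in α..p.1, ψ (y, p.2)) - (∫ y in α..p.1, ρ y) * ∫ y, ψ (y, p.2)) ⊆
      Icc a b ×ˢ (Prod.snd '' tsupport ψ) := by
    intro p hp
    by_contra hmem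
    apply hp
    by_cases h2 : p.2 ∈ Prod.snd '' tsupport ψ
    · have h1 : p.1 ∉ Icc a b := fun h1 => hmem ⟨h1, h2⟩
      rw [mem_Icc, not_and_or, not_le, not_le] at h1
      -- Left of `a` both primitives vanish; right of `b` they have reached their total integrals,
      -- and the two terms cancel because `ρ` has mass one.
      rcases h1 with h1 | h1
      · simp only
        rw [zero _ (fun x hx => hψ0 (x, p.2) hx) _ h1, zero _ hρ0 _ h1]
        simp
      · simp only
        rw [full _ (fun x hx => hψ0 (x, p.2) hx) _ h1, full _ hρ0 _ h1, hρ1]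
        simp
    · have h0 : ∀ y, ψ (y, p.2) = 0 := by
        intro y
        by_contra h0
        exact h2 ⟨(y, p.2), subset_tsupport _ h0, rfl⟩
      simp [h0]
  have hcomp : IsCompact (Icc a b ×ˢ (Prod.snd '' tsupport ψ)) :=
    isCompact_Icc.prod (hψ.2.1.image continuous_snd)
  refine ⟨⟨cψ.sub ((cP.comp contDiff_fst).mul cS),
    HasCompactSupport.of_support_subset_isCompact hcomp hsupp,
    (closure_minimal hsupp hcomp.isClosed).trans (prod_mono ?_ ?_)⟩, ?_⟩
  · exact fun x hx => ⟨by linarith [hx.1], by linarith [hx.2]⟩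
  · rintro _ ⟨p, hp, rfl⟩
    exact (hψ.2.2 hp).2
  · intro p
    simp only [dx, iteratedDeriv_one]
    have c1 : Continuous fun y => ψ (y, p.2) := hψ.1.continuous.comp (by fun_prop)
    have d1 : HasDerivAt (fun x => ∫ y in α..x, ψ (y, p.2)) (ψ (p.1, p.2)) p.1 :=
      intervalIntegral.integral_hasDerivAt_right (c1.intervalIntegrable _ _)
        c1.aestronglyMeasurable.stronglyMeasurableAtFilter c1.continuousAt
    have d2 : HasDerivAt (fun x => ∫ y in α..x, ρ y) (ρ p.1) p.1 :=
      intervalIntegral.integral_hasDerivAt_right (hρ.continuous.intervalIntegrable _ _)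
        hρ.continuous.aestronglyMeasurable.stronglyMeasurableAtFilter hρ.continuous.continuousAt
    exact (d1.sub (d2.mul_const _)).deriv

/-! ### Kernel operators in space and representation by the weak derivative -/

/-- The map is `((x, t), y) ↦ ((y, t), x)`: it exchanges two space variables and keeps the time,
which is the change of variables needed to transpose a kernel. -/
lemma measurePreserving_swap_outer (μ ν : Measure ℝ) [SFinite μ] [SFinite ν] :
    MeasurePreserving ((MeasurableEquiv.prodAssoc.trans MeasurableEquiv.prodComm).trans
      (MeasurableEquiv.prodCongr MeasurableEquiv.prodComm (MeasurableEquiv.refl ℝ)) :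
      (ℝ × ℝ) × ℝ ≃ᵐ (ℝ × ℝ) × ℝ) ((μ.prod ν).prod μ) ((μ.prod ν).prod μ) :=
  (((Measure.measurePreserving_swap (μ := ν) (ν := μ)).prod (MeasurePreserving.id μ)).comp
    (Measure.measurePreserving_swap (μ := μ) (ν := ν.prod μ))).comp
    (measurePreserving_prodAssoc μ ν μ)

section Kernel

variable {μ ν : Measure ℝ} [IsFiniteMeasure μ] [SFinite ν] {u k ψ : ℝ × ℝ → ℝ} {C D : ℝ}

omit [SFinite ν] in
lemma integrable_kernel_aux (hu : Integrable u (μ.prod ν)) (hk : Measurable k)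
    (hkC : ∀ p, |k p| ≤ C) (hψ : Measurable ψ) (hψD : ∀ p, |ψ p| ≤ D) :
    Integrable (fun q : (ℝ × ℝ) × ℝ => u q.1 * (k (q.1.1, q.2) * ψ (q.2, q.1.2)))
      ((μ.prod ν).prod μ) := by
  refine (hu.comp_fst μ).mul_bdd (c := C * D) ?_ ?_
  · apply Measurable.aestronglyMeasurable
    exact (hk.comp (by fun_prop)).mul (hψ.comp (by fun_prop))
  · refine Filter.Eventually.of_forall fun q => ?_
    rw [Real.norm_eq_abs, abs_mul]
    exact mul_le_mul (hkC _) (hψD _) (abs_nonneg _) ((abs_nonneg _).trans (hkC (0, 0)))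

lemma integrable_kernel (hu : Integrable u (μ.prod ν)) (hk : Measurable k)
    (hkC : ∀ p, |k p| ≤ C) (hψ : Measurable ψ) (hψD : ∀ p, |ψ p| ≤ D) :
    Integrable (fun q : (ℝ × ℝ) × ℝ => u (q.2, q.1.2) * (k (q.2, q.1.1) * ψ (q.1.1, q.1.2)))
      ((μ.prod ν).prod μ) :=
  (measurePreserving_swap_outer μ ν).integrable_comp_of_integrable
    (integrable_kernel_aux hu hk hkC hψ hψD)

/-- Fubini: an integral operator in space with bounded kernel is moved from `u` onto the test
function. -/
lemma integral_kernel (hu : Integrable u (μ.prod ν)) (hk : Measurable k)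
    (hkC : ∀ p, |k p| ≤ C) (hψ : Measurable ψ) (hψD : ∀ p, |ψ p| ≤ D) :
    ∫ p, ψ p * ∫ x, u (x, p.2) * k (x, p.1) ∂μ ∂(μ.prod ν) =
      ∫ p, u p * ∫ y, k (p.1, y) * ψ (y, p.2) ∂μ ∂(μ.prod ν) := by
  have h1 := integral_prod _ (integrable_kernel_aux hu hk hkC hψ hψD)
  have h2 := integral_prod _ (integrable_kernel hu hk hkC hψ hψD)
  have h3 := (measurePreserving_swap_outer μ ν).integral_comp
    (MeasurableEquiv.measurableEmbedding _)
    (fun q : (ℝ × ℝ) × ℝ => u q.1 * (k (q.1.1, q.2) * ψ (q.2, q.1.2)))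
  simp only [integral_const_mul] at h1
  have e : ∀ p : ℝ × ℝ, ψ p * ∫ x, u (x, p.2) * k (x, p.1) ∂μ =
      ∫ x, u (x, p.2) * (k (x, p.1) * ψ (p.1, p.2)) ∂μ := by
    intro p
    rw [← integral_const_mul]
    congr 1; ext x; ring
  simp only [e]
  rw [← h1, ← h2]
  exact h3

lemma integrable_integral_kernel (hu : Integrable u (μ.prod ν)) (hk : Measurable k)
    (hkC : ∀ p, |k p| ≤ C) :
    Integrable (fun p : ℝ × ℝ => ∫ x, u (x, p.2) * k (x, p.1) ∂μ) (μ.prod ν) := by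
  have := (integrable_kernel hu hk hkC (ψ := fun _ => 1) measurable_const (D := 1)
    (by simp)).integral_prod_left
  simpa using this

end Kernel

/-- A function with an integrable weak space derivative `g` differs from its weighted mean by an
average of `g` against a kernel bounded by one. -/
lemma ae_sub_mean_eq {α β : ℝ} (hαβ : α < β) {J : Set ℝ} (hJ : IsOpen J) {ρ : ℝ → ℝ}
    (hρ : ContDiff ℝ ∞ ρ) (hρc : HasCompactSupport ρ) (hρs : tsupport ρ ⊆ Ioo α β)
    (hρ1 : ∫ x, ρ x = 1) {f g : ℝ × ℝ → ℝ} (hf : IntegrableOn f (Ioo α β ×ˢ J))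
    (hg : IntegrableOn g (Ioo α β ×ˢ J))
    (hfg : ∀ φ, IsTest (Ioo α β ×ˢ J) φ →
      ∫ p in Ioo α β ×ˢ J, f p * dx 1 φ p = -∫ p in Ioo α β ×ˢ J, g p * φ p) :
    ∀ᵐ p ∂(volume.restrict (Ioo α β ×ˢ J)), f p - ∫ x in Ioo α β, f (x, p.2) * ρ x =
      -∫ x in Ioo α β, g (x, p.2) * ((Iic x).indicator 1 p.1 - ∫ y in α..x, ρ y) := by
  obtain ⟨D, hD⟩ := hρc.exists_bound_of_continuous hρ.continuous
  have hρI : Integrable ρ := hρ.continuous.integrable_of_hasCompactSupport hρc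
  set P : ℝ → ℝ := fun x => ∫ y in α..x, ρ y with hP
  have hPc : Continuous P := intervalIntegral.continuous_primitive
    (fun a b => hρ.continuous.intervalIntegrable a b) α
  set k : ℝ × ℝ → ℝ := fun q => (Iic q.1).indicator 1 q.2 - P q.1 with hk
  have hkm : Measurable k := by
    refine Measurable.sub ?_ (hPc.measurable.comp measurable_fst)
    have : (fun q : ℝ × ℝ => (Iic q.1).indicator (1 : ℝ → ℝ) q.2) =
        {q : ℝ × ℝ | q.2 ≤ q.1}.indicator 1 := by
      ext q; simp [indicator]
    rw [this]
    exact measurable_one.indicator (measurableSet_le measurable_snd measurable_fst)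
  have hkb : ∀ q, |k q| ≤ 1 + ∫ y, ‖ρ y‖ := by
    intro q
    refine (abs_sub _ _).trans (add_le_add ?_ ?_)
    · by_cases h : q.2 ≤ q.1 <;> simp [indicator, h]
    · refine (intervalIntegral.norm_integral_le_integral_norm_uIoc (f := ρ) (a := α) (b := q.1)
        (μ := volume)).trans ?_
      exact setIntegral_le_integral hρI.norm (Filter.Eventually.of_forall fun _ => norm_nonneg _)
  have hvol : (volume : Measure (ℝ × ℝ)).restrict (Ioo α β ×ˢ J) =
      (volume.restrict (Ioo α β)).prod (volume.restrict J) := by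
    rw [Measure.prod_restrict]; rfl
  have hf' := hf
  have hg' := hg
  rw [IntegrableOn, hvol] at hf' hg'
  have hρm : Measurable (fun q : ℝ × ℝ => ρ q.1) := hρ.continuous.measurable.comp measurable_fst
  have i1 := integrable_integral_kernel hf' hρm (fun q => hD q.1)
  have i2 := integrable_integral_kernel hg' hkm hkb
  have hU : IsOpen (Ioo α β ×ˢ J) := isOpen_Ioo.prod hJ
  -- The identity is tested against `ψ`. Both averages are transposed onto `ψ`, and what remains is
  -- `hfg` for the primitive of `ψ - ρ ∫ ψ`.
  have key := hU.ae_eq_zero_of_integral_contDiff_smul_eq_zero (μ := volume)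
    (f := fun p => f p - (∫ x in Ioo α β, f (x, p.2) * ρ x) +
      ∫ x in Ioo α β, g (x, p.2) * k (x, p.1)) ?_ ?_
  · rw [ae_restrict_iff' hU.measurableSet]
    filter_upwards [key] with p hp hpU
    have := hp hpU
    linarith
  · apply IntegrableOn.locallyIntegrableOn
    rw [IntegrableOn, hvol]
    exact (hf'.sub i1).add i2
  · intro ψ hψ hψc hψs
    obtain ⟨E, hE⟩ := hψc.exists_bound_of_continuous hψ.continuous
    obtain ⟨T1, T2⟩ := exists_test_primitive hαβ (J := J) hρ hρc hρs hρ1 ⟨hψ, hψc, hψs⟩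
    have h0 := hfg _ T1
    simp only [T2] at h0
    have hsl : ∀ t, Integrable (fun y => ψ (y, t)) := fun t =>
      (hψ.continuous.comp (by fun_prop)).integrable_of_hasCompactSupport
        (hasCompactSupport_slice hψc t)
    have hsI : ∀ t, ∫ y in Ioo α β, ψ (y, t) = ∫ y, ψ (y, t) := by
      intro t
      refine setIntegral_eq_integral_of_forall_compl_eq_zero fun y hy => ?_
      by_contra h0
      exact hy (hψs (subset_tsupport _ h0)).1
    rw [← setIntegral_eq_integral_of_forall_compl_eq_zero (s := Ioo α β ×ˢ J)]
    swap
    · intro p hp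
      have : ψ p = 0 := by
        by_contra h0
        exact hp (hψs (subset_tsupport _ h0))
      simp [this]
    have f1 := integral_kernel hf' hρm (fun q => hD q.1) hψ.continuous.measurable hE
    have f2 := integral_kernel hg' hkm hkb hψ.continuous.measurable hE
    have e1 : ∀ p : ℝ × ℝ, ∫ y in Ioo α β, ρ p.1 * ψ (y, p.2) = ρ p.1 * ∫ y, ψ (y, p.2) := by
      intro p
      rw [integral_const_mul, hsI]
    -- The kernel is chosen so that its transpose turns `ψ` into exactly the test function of
    -- `exists_test_primitive`.
    have e2 : ∀ p ∈ Ioo α β ×ˢ J, ∫ y in Ioo α β, k (p.1, y) * ψ (y, p.2) =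
        (∫ y in α..p.1, ψ (y, p.2)) - P p.1 * ∫ y, ψ (y, p.2) := by
      intro p hp
      have e3 : ∀ y, k (p.1, y) * ψ (y, p.2) =
          (Iic p.1).indicator (fun y => ψ (y, p.2)) y - P p.1 * ψ (y, p.2) := by
        intro y
        by_cases h : y ≤ p.1
        · simp [hk, indicator, h]
          ring
        · simp [hk, indicator, h]
      simp only [e3]
      rw [integral_sub ((hsl p.2).integrableOn.indicator measurableSet_Iic)
        ((hsl p.2).integrableOn.const_mul _), integral_const_mul, hsI,
        setIntegral_indicator measurableSet_Iic,
        intervalIntegral.integral_of_le hp.1.1.le]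
      congr 2
      congr 1
      ext y
      simp only [mem_inter_iff, mem_Ioo, mem_Iic, mem_Ioc]
      exact ⟨fun h => ⟨h.1.1, h.2⟩, fun h => ⟨⟨h.1, h.2.trans_lt hp.1.2⟩, h.2⟩⟩
    have bd : ∀ {w : ℝ × ℝ → ℝ}, Integrable w
        ((volume.restrict (Ioo α β)).prod (volume.restrict J)) →
        Integrable (fun p => ψ p * w p)
          ((volume.restrict (Ioo α β)).prod (volume.restrict J)) := fun hw =>
      hw.bdd_mul hψ.continuous.aestronglyMeasurable (Filter.Eventually.of_forall hE)
    have s1 := integral_add ((bd hf').sub (bd i1)) (bd i2)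
    have s2 := integral_sub (bd hf') (bd i1)
    have f3 : ∫ p in Ioo α β ×ˢ J, g p * ∫ y in Ioo α β, k (p.1, y) * ψ (y, p.2) =
        ∫ p in Ioo α β ×ˢ J, g p * ((∫ y in α..p.1, ψ (y, p.2)) - P p.1 * ∫ y, ψ (y, p.2)) :=
      setIntegral_congr_fun hU.measurableSet fun p hp => by simp only [e2 p hp]
    have i3 : Integrable (fun p : ℝ × ℝ => f p * (ρ p.1 * ∫ y, ψ (y, p.2)))
        ((volume.restrict (Ioo α β)).prod (volume.restrict J)) := by
      have := (integrable_kernel_aux hf' hρm (fun q => hD q.1) hψ.continuous.measurable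
        hE).integral_prod_left
      simpa only [integral_const_mul, hsI] using this
    have s3 := integral_sub (bd hf') i3
    simp only [e1] at f1
    rw [hvol] at f3 h0 ⊢
    have e4 : ∀ p : ℝ × ℝ, f p * (ψ p - ρ p.1 * ∫ y, ψ (y, p.2)) =
        ψ p * f p - f p * (ρ p.1 * ∫ y, ψ (y, p.2)) := fun p => by ring
    simp only [e4] at h0
    simp only [smul_eq_mul, mul_add, mul_sub]
    refine s1.trans ?_
    refine (congrArg₂ (· + ·) s2 rfl).trans ?_
    linarith

lemma volume_restrict_prod (I J : Set ℝ) : (volume : Measure (ℝ × ℝ)).restrict (I ×ˢ J) =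
    (volume.restrict I).prod (volume.restrict J) := by
  rw [Measure.prod_restrict]; rfl

/-- The oscillation about a weighted mean is controlled by the integral of the weak derivative. -/
lemma ae_abs_sub_mean_le {α β : ℝ} (hαβ : α < β) {J : Set ℝ} (hJ : IsOpen J) {a : ℝ → ℝ}
    (ha : ContDiff ℝ ∞ a) (hac : HasCompactSupport a) (has : tsupport a ⊆ Ioo α β)
    (ha0 : ∀ x, 0 ≤ a x) (ha1 : 0 < ∫ x, a x) {f g : ℝ × ℝ → ℝ}
    (hf : IntegrableOn f (Ioo α β ×ˢ J)) (hg : IntegrableOn g (Ioo α β ×ˢ J))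
    (hfg : ∀ φ, IsTest (Ioo α β ×ˢ J) φ →
      ∫ p in Ioo α β ×ˢ J, f p * dx 1 φ p = -∫ p in Ioo α β ×ˢ J, g p * φ p) :
    ∀ᵐ p ∂(volume.restrict (Ioo α β ×ˢ J)),
      |f p - (∫ x in Ioo α β, f (x, p.2) * a x) * (∫ x, a x)⁻¹| ≤ ∫ x in Ioo α β, |g (x, p.2)| := by
  set Φ := ∫ x, a x with hΦ
  have haI : Integrable a := ha.continuous.integrable_of_hasCompactSupport hac
  have hρI : Integrable (fun x => a x * Φ⁻¹) := haI.mul_const _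
  have hρ1 : ∫ x, a x * Φ⁻¹ = 1 := by
    rw [integral_mul_const, mul_inv_cancel₀ ha1.ne']
  have key := ae_sub_mean_eq hαβ hJ (ρ := fun x => a x * Φ⁻¹) (ha.mul contDiff_const)
    hac.mul_right ((tsupport_mul_subset_left).trans has) hρ1 hf hg hfg
  have hg' := hg
  rw [IntegrableOn, volume_restrict_prod] at hg'
  have hsl : ∀ᵐ p ∂(volume.restrict (Ioo α β ×ˢ J)),
      IntegrableOn (fun x => g (x, p.2)) (Ioo α β) := by
    rw [volume_restrict_prod]
    exact Measure.quasiMeasurePreserving_snd.ae hg'.prod_left_ae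
  filter_upwards [key, hsl] with p hp hi
  have e : (∫ x in Ioo α β, f (x, p.2) * a x) * Φ⁻¹ =
      ∫ x in Ioo α β, f (x, p.2) * (a x * Φ⁻¹) := by
    rw [← integral_mul_const]
    congr 1; ext x; ring
  rw [e, hp, abs_neg, ← Real.norm_eq_abs]
  refine norm_integral_le_of_norm_le hi.abs ?_
  filter_upwards [self_mem_ae_restrict measurableSet_Ioo] with x hx
  rw [norm_mul, Real.norm_eq_abs]
  refine mul_le_of_le_one_right (abs_nonneg _) ?_
  -- As the weight is nonnegative with mass one, its primitive lies in `[0, 1]`; hence `0` or `1`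
  -- minus it has absolute value at most one.
  have p0 : 0 ≤ ∫ y in α..x, a y * Φ⁻¹ :=
    intervalIntegral.integral_nonneg hx.1.le fun y _ => mul_nonneg (ha0 y) (inv_nonneg.2 ha1.le)
  have p1 : ∫ y in α..x, a y * Φ⁻¹ ≤ 1 := by
    rw [intervalIntegral.integral_of_le hx.1.le, ← hρ1]
    exact setIntegral_le_integral hρI (Filter.Eventually.of_forall fun y =>
      mul_nonneg (ha0 y) (inv_nonneg.2 ha1.le))
  rw [Real.norm_eq_abs, abs_le]
  by_cases h : p.1 ≤ x
  · simp only [indicator, mem_Iic, h, if_true, Pi.one_apply]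
    constructor <;> linarith
  · simp only [indicator, mem_Iic, h, if_false]
    constructor <;> linarith

/-! ### Functions of time with an integrable weak derivative -/

lemma exists_normalized_bump {σ τ : ℝ} (h : σ < τ) : ∃ ρ : ℝ → ℝ, ContDiff ℝ ∞ ρ ∧
    HasCompactSupport ρ ∧ tsupport ρ ⊆ Ioo σ τ ∧ ∫ x, ρ x = 1 := by
  let b : ContDiffBump ((σ + τ) / 2) := ⟨(τ - σ) / 8, (τ - σ) / 4, by linarith, by linarith⟩
  refine ⟨b.normed volume, b.contDiff_normed, b.hasCompactSupport_normed, ?_, b.integral_normed⟩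
  rw [b.tsupport_normed_eq, Real.closedBall_eq_Icc]
  intro x hx
  have e : b.rOut = (τ - σ) / 4 := rfl
  rw [e] at hx
  exact ⟨by linarith [hx.1], by linarith [hx.2]⟩

/-- An integrable function with integrable weak derivative is a.e. a primitive of it. -/
lemma ae_eq_const_add_integral {σ τ : ℝ} (h : σ < τ) {M N : ℝ → ℝ}
    (hM : IntegrableOn M (Ioo σ τ)) (hN : IntegrableOn N (Ioo σ τ))
    (hMN : ∀ θ : ℝ → ℝ, ContDiff ℝ ∞ θ → HasCompactSupport θ → tsupport θ ⊆ Ioo σ τ →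
      ∫ t in Ioo σ τ, M t * deriv θ t = -∫ t in Ioo σ τ, N t * θ t) :
    ∃ c, ∀ᵐ t ∂(volume.restrict (Ioo σ τ)), M t = c + ∫ s in σ..t, N s := by
  obtain ⟨ρ, hρ, hρc, hρs, hρ1⟩ := exists_normalized_bump h
  have bdd : ∀ {φ : ℝ × ℝ → ℝ}, Continuous φ → HasCompactSupport φ → ∀ {u : ℝ → ℝ},
      IntegrableOn u (Ioo σ τ) → Integrable (fun p : ℝ × ℝ => u p.1 * φ p)
        ((volume.restrict (Ioo σ τ)).prod (volume.restrict (Ioo (0 : ℝ) 1))) := by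
    intro φ hφ hφc u hu
    obtain ⟨D, hD⟩ := hφc.exists_bound_of_continuous hφ
    exact (hu.comp_fst (volume.restrict (Ioo (0 : ℝ) 1))).mul_bdd hφ.aestronglyMeasurable
      (Filter.Eventually.of_forall hD)
  -- The one-variable statement is the planar one for functions that do not depend on a dummy second
  -- variable in `(0, 1)`.
  have key := ae_sub_mean_eq h (J := Ioo (0 : ℝ) 1) isOpen_Ioo hρ hρc hρs hρ1
    (f := fun p => M p.1) (g := fun p => N p.1)
    (by rw [IntegrableOn, volume_restrict_prod]; exact hM.comp_fst _)
    (by rw [IntegrableOn, volume_restrict_prod]; exact hN.comp_fst _) ?_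
  swap
  · intro φ hφ
    have hφ1 := hφ.dx 1
    rw [volume_restrict_prod, integral_prod_symm _ (bdd hφ1.1.continuous hφ1.2.1 hM),
      integral_prod_symm _ (bdd hφ.1.continuous hφ.2.1 hN), ← integral_neg]
    congr 1
    ext y
    have := hMN (fun x => φ (x, y)) (hφ.1.comp (contDiff_id.prodMk contDiff_const))
      (hasCompactSupport_slice hφ.2.1 y) ?_
    · simpa only [dx, iteratedDeriv_one] using this
    · intro x hx
      have hcl : IsClosed ((fun x : ℝ => (x, y)) ⁻¹' tsupport φ) :=
        (isClosed_tsupport _).preimage (by fun_prop)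
      exact (hφ.2.2 (closure_minimal (s := Function.support fun x => φ (x, y))
        (fun x hx => subset_tsupport φ hx) hcl hx : x ∈ _)).1
  -- The constant appears on splitting the kernel as `1 - 1_{r < s} - ∫_σ^r ρ`: only the middle
  -- piece depends on `s`, and it yields the primitive of `N`.
  refine ⟨(∫ x in Ioo σ τ, M x * ρ x) - (∫ r in Ioo σ τ, N r) +
    ∫ r in Ioo σ τ, N r * ∫ y in σ..r, ρ y, ?_⟩
  rw [volume_restrict_prod] at key
  have key2 := Measure.ae_ae_of_ae_prod key
  have hne : (ae (volume.restrict (Ioo (0 : ℝ) 1))).NeBot := by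
    rw [ae_neBot]
    simp
  filter_upwards [key2, self_mem_ae_restrict measurableSet_Ioo] with s hs hsI
  obtain ⟨y, hy⟩ := hs.exists
  have hPc : Continuous fun r => ∫ y in σ..r, ρ y := intervalIntegral.continuous_primitive
    (fun a b => hρ.continuous.intervalIntegrable a b) σ
  have hNP : IntegrableOn (fun r => N r * ∫ y in σ..r, ρ y) (Ioo σ τ) := by
    have := (integrableOn_Icc_iff_integrableOn_Ioo (μ := volume)).2 hN
    exact (this.mul_continuousOn hPc.continuousOn isCompact_Icc).mono_set Ioo_subset_Icc_self
  have e : ∀ r, N r * ((Iic r).indicator 1 s - ∫ y in σ..r, ρ y) =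
      N r - (Iio s).indicator N r - N r * ∫ y in σ..r, ρ y := by
    intro r
    by_cases hr : s ≤ r
    · simp [indicator, hr, not_lt.2 hr]; ring
    · simp [indicator, hr, not_le.1 hr]
  simp only [e] at hy
  have s1 := integral_sub (hN.sub (hN.indicator (measurableSet_Iio (a := s)))) hNP
  have s2 := integral_sub hN (hN.indicator (measurableSet_Iio (a := s)))
  simp only [Pi.sub_apply] at s1
  rw [s1, s2, setIntegral_indicator measurableSet_Iio] at hy
  have e2 : ∫ r in σ..s, N r = ∫ r in Ioo σ τ ∩ Iio s, N r := by
    rw [intervalIntegral.integral_of_le hsI.1.le, integral_Ioc_eq_integral_Ioo]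
    congr 2
    ext r
    simp only [mem_inter_iff, mem_Ioo, mem_Iio]
    exact ⟨fun h => ⟨⟨h.1, h.2.trans hsI.2⟩, h.2⟩, fun h => ⟨h.1.1, h.2⟩⟩
  rw [e2]
  linarith

/-- Product rule for absolutely continuous functions: the primitive of `N` has derivative `N` almost
everywhere, and the boundary term at `σ` drops out since `θ σ = 0`. -/
lemma mul_sq_eq_integral {σ τ c : ℝ} {N θ : ℝ → ℝ} (hN : IntegrableOn N (Ioo σ τ))
    (hθ : ContDiff ℝ ∞ θ) (hθ0 : θ σ = 0) {t : ℝ} (ht : t ∈ Ioo σ τ) :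
    θ t * (c + ∫ s in σ..t, N s) ^ 2 = ∫ s in Ioo σ t,
      (deriv θ s * (c + ∫ r in σ..s, N r) ^ 2 + 2 * θ s * (c + ∫ r in σ..s, N r) * N s) := by
  have hNi : IntervalIntegrable N volume σ t := by
    rw [intervalIntegrable_iff_integrableOn_Ioo_of_le ht.1.le]
    exact hN.mono_set (Ioo_subset_Ioo_right ht.2.le)
  have hμ : AbsolutelyContinuousOnInterval (fun s => c + ∫ r in σ..s, N r) σ t :=
    (contDiff_const.contDiffOn.absolutelyContinuousOnInterval (f := fun _ => c)).add
      (hNi.absolutelyContinuousOnInterval_intervalIntegral left_mem_uIcc)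
  have hθac : AbsolutelyContinuousOnInterval θ σ t :=
    (hθ.of_le (by exact_mod_cast le_top)).contDiffOn.absolutelyContinuousOnInterval
  have h1 := hθac.integral_deriv_mul_eq_sub (hμ.mul hμ)
  simp only [Pi.mul_apply, hθ0, zero_mul, sub_zero] at h1
  rw [sq, ← h1, intervalIntegral.integral_of_le ht.1.le, integral_Ioc_eq_integral_Ioo]
  refine setIntegral_congr_ae measurableSet_Ioo ?_
  filter_upwards [hNi.ae_hasDerivAt_integral] with s hs hsI
  have hd : HasDerivAt (fun s => c + ∫ r in σ..s, N r) (N s) s :=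
    (hs (Icc_subset_uIcc ⟨hsI.1.le, hsI.2.le⟩) σ left_mem_uIcc).const_add c
  rw [(hd.mul hd).deriv]
  ring

/-- The balance of `θ M²` for a function `M` with integrable weak derivative `N`. -/
lemma ae_mul_sq_eq_integral {σ τ : ℝ} (h : σ < τ) {M N θ : ℝ → ℝ}
    (hM : IntegrableOn M (Ioo σ τ)) (hN : IntegrableOn N (Ioo σ τ))
    (hMN : ∀ θ : ℝ → ℝ, ContDiff ℝ ∞ θ → HasCompactSupport θ → tsupport θ ⊆ Ioo σ τ →
      ∫ t in Ioo σ τ, M t * deriv θ t = -∫ t in Ioo σ τ, N t * θ t)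
    (hθ : ContDiff ℝ ∞ θ) (hθ0 : θ σ = 0) :
    ∀ᵐ t ∂(volume.restrict (Ioo σ τ)), θ t * M t ^ 2 =
      ∫ s in Ioo σ t, (deriv θ s * M s ^ 2 + 2 * θ s * M s * N s) := by
  obtain ⟨c, hc⟩ := ae_eq_const_add_integral h hM hN hMN
  filter_upwards [hc, self_mem_ae_restrict measurableSet_Ioo] with t ht htI
  rw [ht, mul_sq_eq_integral hN hθ hθ0 htI]
  refine integral_congr_ae ?_
  filter_upwards [ae_restrict_of_ae_restrict_of_subset (Ioo_subset_Ioo_right htI.2.le) hc]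
    with s hs
  rw [hs]

/-! ### Mixed Lebesgue norms on the cylinder -/

lemma volume_restrict_openCyl (z : ℝ × ℝ) (R : ℝ) :
    (volume : Measure (ℝ × ℝ)).restrict (openCyl z R) =
      (volume.restrict (spaceI z R)).prod (volume.restrict (timeI z R)) :=
  volume_restrict_prod _ _

lemma isOpen_openCyl (z : ℝ × ℝ) (R : ℝ) : IsOpen (openCyl z R) := isOpen_Ioo.prod isOpen_Ioo

instance (z : ℝ × ℝ) (R : ℝ) : IsFiniteMeasure (volume.restrict (spaceI z R)) :=
  inferInstanceAs (IsFiniteMeasure (volume.restrict (Ioo _ _)))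

instance (z : ℝ × ℝ) (R : ℝ) : IsFiniteMeasure (volume.restrict (timeI z R)) :=
  inferInstanceAs (IsFiniteMeasure (volume.restrict (Ioo _ _)))

instance (z : ℝ × ℝ) (R : ℝ) : IsFiniteMeasure (volume.restrict (openCyl z R)) := by
  rw [volume_restrict_openCyl]; infer_instance

section Lpq

variable {z : ℝ × ℝ} {R : ℝ} {f : ℝ × ℝ → ℝ}

lemma eLpNorm_two_sq {X : Type*} [MeasurableSpace X] (μ : Measure X) (f : X → ℝ) :
    eLpNorm f 2 μ ^ 2 = ∫⁻ x, ‖f x‖ₑ ^ 2 ∂μ := by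
  have := eLpNorm_nnreal_pow_eq_lintegral (f := f) (μ := μ) (p := 2) (by simp)
  simpa using this

lemma memLp_two_of_lintegral_slices (hf : AEStronglyMeasurable f (volume.restrict (openCyl z R)))
    (h : ∫⁻ t in timeI z R,
      eLpNorm (fun x => f (x, t)) 2 (volume.restrict (spaceI z R)) ^ 2 < ⊤) :
    MemLp f 2 (volume.restrict (openCyl z R)) := by
  refine ⟨hf, ?_⟩
  have h1 : eLpNorm f 2 (volume.restrict (openCyl z R)) ^ 2 < ⊤ := by
    rw [eLpNorm_two_sq]
    rw [volume_restrict_openCyl] at hf ⊢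
    rw [lintegral_prod_symm _ (hf.enorm.pow_const 2)]
    simpa only [eLpNorm_two_sq] using h
  exact (ENNReal.pow_lt_top_iff).1 h1 |>.resolve_right (by norm_num)

lemma MemLpq.memLp_two (hf : MemLpq 2 2 z R f) : MemLp f 2 (volume.restrict (openCyl z R)) := by
  refine memLp_two_of_lintegral_slices hf.1 ?_
  have := eLpNorm_nnreal_pow_eq_lintegral (p := 2) (μ := volume.restrict (timeI z R))
    (f := fun t => eLpNorm (fun x => f (x, t)) 2 (volume.restrict (spaceI z R))) (by simp)
  simp only [NNReal.coe_ofNat, ENNReal.rpow_ofNat, enorm_eq_self, ENNReal.coe_ofNat] at this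
  rw [← this]
  exact ENNReal.pow_lt_top hf.2

lemma MemLpq.ae_le (hf : MemLpq 2 ⊤ z R f) : ∃ B : ℝ≥0∞, B < ⊤ ∧
    ∀ᵐ t ∂(volume.restrict (timeI z R)),
      eLpNorm (fun x => f (x, t)) 2 (volume.restrict (spaceI z R)) ^ 2 ≤ B := by
  have h2 := hf.2
  rw [eLpNorm_exponent_top] at h2
  refine ⟨_, ENNReal.pow_lt_top (n := 2) h2, ?_⟩
  filter_upwards [enorm_ae_le_eLpNormEssSup
    (fun t => eLpNorm (fun x => f (x, t)) 2 (volume.restrict (spaceI z R)))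
    (volume.restrict (timeI z R))] with t ht
  gcongr
  simpa using ht

lemma MemLpq.memLp_two_of_top (hf : MemLpq 2 ⊤ z R f) :
    MemLp f 2 (volume.restrict (openCyl z R)) := by
  refine memLp_two_of_lintegral_slices hf.1 ?_
  obtain ⟨B, hB, h⟩ := hf.ae_le
  refine (lintegral_mono_ae h).trans_lt ?_
  rw [lintegral_const]
  exact ENNReal.mul_lt_top hB (measure_lt_top _ _)

/-- Makes the weighted mean essentially bounded in time, so that products with the mean and its
square stay integrable. -/
lemma MemLpq.exists_bound_integral (hf : MemLpq 2 ⊤ z R f) {a : ℝ → ℝ} {D : ℝ}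
    (ha : ∀ x, ‖a x‖ ≤ D) : ∃ B : ℝ, ∀ᵐ t ∂(volume.restrict (timeI z R)),
      |∫ x in spaceI z R, f (x, t) * a x| ≤ B := by
  obtain ⟨B, hB, h⟩ := hf.ae_le
  have hfin : (volume (spaceI z R) + B) * ENNReal.ofReal D ≠ ⊤ := by
    refine ENNReal.mul_ne_top (ENNReal.add_ne_top.2 ⟨?_, hB.ne⟩) ENNReal.ofReal_ne_top
    simp [spaceI]
  refine ⟨((volume (spaceI z R) + B) * ENNReal.ofReal D).toReal, ?_⟩
  filter_upwards [h] with t ht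
  rw [← Real.norm_eq_abs, ← toReal_enorm]
  refine ENNReal.toReal_mono hfin ((enorm_integral_le_lintegral_enorm _).trans ?_)
  rw [eLpNorm_two_sq] at ht
  -- Only finiteness matters here, so `s ≤ 1 + s²` replaces Cauchy-Schwarz.
  calc ∫⁻ x in spaceI z R, ‖f (x, t) * a x‖ₑ
      ≤ ∫⁻ x in spaceI z R, (1 + ‖f (x, t)‖ₑ ^ 2) * ENNReal.ofReal D := by
        refine lintegral_mono fun x => ?_
        simp only [enorm_mul]
        refine mul_le_mul' ?_ ?_
        · rcases le_total ‖f (x, t)‖ₑ 1 with h1 | h1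
          · exact h1.trans (by simp)
          · exact (le_self_pow₀ h1 two_ne_zero).trans le_add_self
        · rw [← ofReal_norm]
          exact ENNReal.ofReal_le_ofReal (ha x)
    _ ≤ _ := by
        rw [lintegral_mul_const' _ _ ENNReal.ofReal_ne_top, lintegral_add_left measurable_const]
        gcongr
        simp

end Lpq

/-! ### Uniqueness of weak derivatives and subtraction of functions of time -/

lemma IsTest.integrable_mul {U : Set (ℝ × ℝ)} {φ g : ℝ × ℝ → ℝ} (h : IsTest U φ)
    (hg : LocallyIntegrableOn g U) : Integrable (fun p => φ p * g p) := by
  obtain ⟨D, hD⟩ := h.2.1.exists_bound_of_continuous h.1.continuous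
  rw [← integrableOn_iff_integrable_of_support_subset (s := tsupport φ)]
  · exact (hg.integrableOn_compact_subset h.2.2 h.2.1).bdd_mul
      h.1.continuous.aestronglyMeasurable (Filter.Eventually.of_forall hD)
  · exact (Function.support_mul_subset_left φ g).trans (subset_tsupport φ)

/-- Fundamental lemma of the calculus of variations. It reduces a claim about arbitrary versions of
the weak derivatives to one particular choice. -/
lemma HasWeakDx.ae_eq {k : ℕ} {z : ℝ × ℝ} {R : ℝ} {f g g' : ℝ × ℝ → ℝ}
    (h : HasWeakDx k z R f g) (h' : HasWeakDx k z R f g') :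
    g =ᵐ[volume.restrict (openCyl z R)] g' := by
  have hU := isOpen_openCyl z R
  have key := hU.ae_eq_zero_of_integral_contDiff_smul_eq_zero (μ := volume)
    (h.2.1.sub h'.2.1) ?_
  · rw [Filter.EventuallyEq, ae_restrict_iff' hU.measurableSet]
    filter_upwards [key] with p hp hpU
    exact sub_eq_zero.1 (hp hpU)
  · intro φ hφ hφc hφs
    have hT : IsTest (openCyl z R) φ := ⟨hφ, hφc, hφs⟩
    have e := (h.2.2 φ hT).symm.trans (h'.2.2 φ hT)
    have e1 := mul_left_cancel₀ (pow_ne_zero k (by norm_num)) e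
    have full : ∀ u : ℝ × ℝ → ℝ, ∫ p in openCyl z R, u p * φ p = ∫ p, φ p * u p := by
      intro u
      rw [setIntegral_eq_integral_of_forall_compl_eq_zero]
      · simp only [mul_comm]
      · intro p hp
        have : φ p = 0 := by
          by_contra h0
          exact hp (hφs (subset_tsupport _ h0))
        simp [this]
    rw [full, full] at e1
    simp only [Pi.sub_apply, smul_eq_mul, mul_sub]
    rw [integral_sub (hT.integrable_mul h.2.1) (hT.integrable_mul h'.2.1), e1, sub_self]

/-- Subtracting an integrable function of time does not change weak space derivatives. -/
lemma HasWeakDx.sub_time {k : ℕ} {z : ℝ × ℝ} {R : ℝ} {f g : ℝ × ℝ → ℝ}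
    (h : HasWeakDx (k + 1) z R f g) (hf : IntegrableOn f (openCyl z R)) {m : ℝ → ℝ}
    (hm : IntegrableOn m (timeI z R)) : HasWeakDx (k + 1) z R (fun p => f p - m p.2) g := by
  have hm2 : IntegrableOn (fun p : ℝ × ℝ => m p.2) (openCyl z R) := by
    rw [IntegrableOn, volume_restrict_openCyl]
    exact hm.comp_snd _
  refine ⟨(hf.sub hm2).locallyIntegrableOn, h.2.1, fun φ hφ => ?_⟩
  rw [← h.2.2 φ hφ]
  have hφ' := hφ.dx (k + 1)
  obtain ⟨D, hD⟩ := hφ'.2.1.exists_bound_of_continuous hφ'.1.continuous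
  have b : ∀ {u : ℝ × ℝ → ℝ}, IntegrableOn u (openCyl z R) →
      IntegrableOn (fun p => u p * dx (k + 1) φ p) (openCyl z R) := fun hu =>
    hu.mul_bdd hφ'.1.continuous.aestronglyMeasurable (Filter.Eventually.of_forall hD)
  simp only [sub_mul]
  have s := integral_sub (b hf) (b hm2)
  refine s.trans ?_
  have h0 : ∫ p in openCyl z R, m p.2 * dx (k + 1) φ p = 0 := by
    have b2 := b hm2
    rw [IntegrableOn, volume_restrict_openCyl] at b2
    rw [volume_restrict_openCyl, integral_prod_symm _ b2]
    refine integral_eq_zero_of_ae (Filter.Eventually.of_forall fun t => ?_)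
    simp only [integral_const_mul, Pi.zero_apply]
    rw [setIntegral_eq_integral_of_forall_compl_eq_zero, hφ.integral_dx_succ_slice, mul_zero]
    intro x hx
    by_contra h0
    exact hx (hφ'.2.2 (subset_tsupport _ h0)).1
  rw [h0, sub_zero]

/-! ### Rescaled spatial cut-offs and test functions with separated variables -/

section SpaceCut

variable {φ₀ : ℝ → ℝ} (hφ₀ : IsSpaceCutoff φ₀) (z : ℝ × ℝ) {R : ℝ} (hR : 0 < R)
include hφ₀

lemma contDiff_spaceCut (R : ℝ) : ContDiff ℝ ∞ (spaceCut φ₀ z R) :=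
  hφ₀.1.comp ((contDiff_id.sub contDiff_const).div_const R)

lemma spaceCut_nonneg (R x : ℝ) : 0 ≤ spaceCut φ₀ z R x := hφ₀.2.2.2.1 _

include hR

omit hφ₀ in
lemma support_spaceCut_subset : Function.support (spaceCut φ₀ z R) ⊆
    (fun y => z.1 + R * y) '' tsupport φ₀ := by
  intro x hx
  refine ⟨(x - z.1) / R, subset_tsupport _ hx, ?_⟩
  field_simp
  ring

lemma hasCompactSupport_spaceCut : HasCompactSupport (spaceCut φ₀ z R) :=
  HasCompactSupport.of_support_subset_isCompact (hφ₀.2.1.image (by fun_prop))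
    (support_spaceCut_subset z hR)

lemma tsupport_spaceCut_subset : tsupport (spaceCut φ₀ z R) ⊆ spaceI z R := by
  refine (closure_minimal (support_spaceCut_subset z hR)
    (IsCompact.image hφ₀.2.1 (by fun_prop)).isClosed).trans ?_
  rintro _ ⟨y, hy, rfl⟩
  have := hφ₀.2.2.1 hy
  simp only [spaceI, mem_Ioo] at this ⊢
  constructor <;> nlinarith [this.1, this.2]

lemma integral_spaceCut_eq : ∫ x in spaceI z R, spaceCut φ₀ z R x = ∫ x, spaceCut φ₀ z R x := by
  refine setIntegral_eq_integral_of_forall_compl_eq_zero fun x hx => ?_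
  by_contra h0
  exact hx (tsupport_spaceCut_subset hφ₀ z hR (subset_tsupport _ h0))

lemma integral_spaceCut_pos : 0 < ∫ x, spaceCut φ₀ z R x := by
  refine (contDiff_spaceCut hφ₀ z R).continuous.integral_pos_of_hasCompactSupport_nonneg_nonzero
    (hasCompactSupport_spaceCut hφ₀ z hR) (spaceCut_nonneg hφ₀ z R) (x := z.1) ?_
  rw [spaceCut, sub_self, zero_div, hφ₀.2.2.2.2.2 0 (by norm_num)]
  norm_num

omit hR in
-- Source of the powers of `1 / R` contributed by spatial derivatives of the cut-off.
lemma iteratedDeriv_spaceCut (k : ℕ) (x : ℝ) :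
    iteratedDeriv k (spaceCut φ₀ z R) x = (R ^ k)⁻¹ * iteratedDeriv k φ₀ ((x - z.1) / R) := by
  have e : spaceCut φ₀ z R = fun y => (fun w => φ₀ (R⁻¹ * w)) (y - z.1) := by
    ext y; simp only [spaceCut]; congr 1; ring
  rw [e, iteratedDeriv_comp_sub_const k (fun w => φ₀ (R⁻¹ * w)) z.1,
    iteratedDeriv_comp_const_mul (hφ₀.1.of_le (by exact_mod_cast le_top))]
  simp only [inv_pow]
  congr 2; ring

end SpaceCut

section OneVariable

variable {a : ℝ → ℝ}

lemma contDiff_iteratedDeriv (ha : ContDiff ℝ ∞ a) (k : ℕ) : ContDiff ℝ ∞ (iteratedDeriv k a) := by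
  induction k with
  | zero => simpa using ha
  | succ k ih =>
    rw [iteratedDeriv_succ]
    exact (contDiff_infty_iff_deriv.1 ih).2

lemma tsupport_iteratedDeriv_subset (a : ℝ → ℝ) (k : ℕ) :
    tsupport (iteratedDeriv k a) ⊆ tsupport a := by
  induction k with
  | zero => simp
  | succ k ih =>
    rw [iteratedDeriv_succ]
    exact (tsupport_deriv_subset (f := iteratedDeriv k a)).trans ih

lemma hasCompactSupport_iteratedDeriv (hac : HasCompactSupport a) (k : ℕ) :
    HasCompactSupport (iteratedDeriv k a) :=
  HasCompactSupport.of_support_subset_isCompact hac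
    ((subset_tsupport _).trans (tsupport_iteratedDeriv_subset a k))

lemma exists_bound_iteratedDeriv (ha : ContDiff ℝ ∞ a) (hac : HasCompactSupport a) (k : ℕ) :
    ∃ D, ∀ x, ‖iteratedDeriv k a x‖ ≤ D :=
  (hasCompactSupport_iteratedDeriv hac k).exists_bound_of_continuous
    (contDiff_iteratedDeriv ha k).continuous

lemma integral_iteratedDeriv_succ (ha : ContDiff ℝ ∞ a) (hac : HasCompactSupport a) (k : ℕ) :
    ∫ x, iteratedDeriv (k + 1) a x = 0 := by
  refine integral_eq_zero_of_hasDerivAt_of_integrable (f := iteratedDeriv k a) ?_ ?_ ?_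
  · intro x
    rw [iteratedDeriv_succ]
    exact ((contDiff_iteratedDeriv ha k).differentiable (by simp) x).hasDerivAt
  · exact (contDiff_iteratedDeriv ha (k + 1)).continuous.integrable_of_hasCompactSupport
      (hasCompactSupport_iteratedDeriv hac (k + 1))
  · exact (contDiff_iteratedDeriv ha k).continuous.integrable_of_hasCompactSupport
      (hasCompactSupport_iteratedDeriv hac k)

lemma setIntegral_eq_of_tsupport_subset {I : Set ℝ} {b : ℝ → ℝ} (h : tsupport b ⊆ I) :
    ∫ x in I, b x = ∫ x, b x := by
  refine setIntegral_eq_integral_of_forall_compl_eq_zero fun x hx => ?_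
  by_contra h0
  exact hx (h (subset_tsupport _ h0))

end OneVariable

section Separated

variable {a θ : ℝ → ℝ}

lemma isTest_mul {I S : Set ℝ} (ha : ContDiff ℝ ∞ a) (hac : HasCompactSupport a)
    (has : tsupport a ⊆ I) (hθ : ContDiff ℝ ∞ θ) (hθc : HasCompactSupport θ)
    (hθs : tsupport θ ⊆ S) : IsTest (I ×ˢ S) (fun p => θ p.2 * a p.1) := by
  have hs : Function.support (fun p : ℝ × ℝ => θ p.2 * a p.1) ⊆ tsupport a ×ˢ tsupport θ := by
    intro p hp
    have hp' : θ p.2 * a p.1 ≠ 0 := hp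
    exact ⟨subset_tsupport _ (right_ne_zero_of_mul hp'),
      subset_tsupport _ (left_ne_zero_of_mul hp')⟩
  have hK : IsCompact (tsupport a ×ˢ tsupport θ) := IsCompact.prod hac hθc
  exact ⟨(hθ.comp contDiff_snd).mul (ha.comp contDiff_fst),
    HasCompactSupport.of_support_subset_isCompact hK hs,
    (closure_minimal hs hK.isClosed).trans (prod_mono has hθs)⟩

lemma dx_mul (k : ℕ) (p : ℝ × ℝ) :
    dx k (fun p => θ p.2 * a p.1) p = θ p.2 * iteratedDeriv k a p.1 := by
  simp only [dx]
  exact iteratedDeriv_const_mul_field (θ p.2) a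

lemma dt_mul (p : ℝ × ℝ) : dt (fun p => θ p.2 * a p.1) p = deriv θ p.2 * a p.1 := by
  simp only [dt]
  exact deriv_mul_const_field (a p.1)

variable {I J : Set ℝ} {u : ℝ × ℝ → ℝ} {b c : ℝ → ℝ} {B D : ℝ}

/-- The time factor is only measurable and essentially bounded, so that it may be a product of `θ`
or `deriv θ` with powers of the mean. -/
lemma integrableOn_mul_sep (hu : IntegrableOn u (I ×ˢ J)) (hb : Continuous b)
    (hbD : ∀ x, ‖b x‖ ≤ D) (hc : AEStronglyMeasurable c (volume.restrict J))
    (hcB : ∀ᵐ t ∂(volume.restrict J), |c t| ≤ B) :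
    IntegrableOn (fun p : ℝ × ℝ => u p * (c p.2 * b p.1)) (I ×ˢ J) := by
  refine hu.mul_bdd (c := B * D) ?_ ?_
  · rw [volume_restrict_prod]
    exact hc.comp_snd.mul (hb.comp continuous_fst).aestronglyMeasurable
  · rw [volume_restrict_prod]
    filter_upwards [Measure.quasiMeasurePreserving_snd.ae hcB] with p hp
    rw [norm_mul]
    exact mul_le_mul hp (hbD _) (norm_nonneg _) ((abs_nonneg _).trans hp)

lemma integral_mul_sep (hu : IntegrableOn u (I ×ˢ J)) (hb : Continuous b)
    (hbD : ∀ x, ‖b x‖ ≤ D) (hc : AEStronglyMeasurable c (volume.restrict J))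
    (hcB : ∀ᵐ t ∂(volume.restrict J), |c t| ≤ B) :
    ∫ p in I ×ˢ J, u p * (c p.2 * b p.1) = ∫ t in J, c t * ∫ x in I, u (x, t) * b x := by
  have h := integrableOn_mul_sep hu hb hbD hc hcB
  rw [IntegrableOn, volume_restrict_prod] at h
  rw [volume_restrict_prod, integral_prod_symm _ h]
  congr 1; ext t
  rw [← integral_const_mul]
  congr 1; ext x; ring

lemma integrableOn_integral_mul (hu : IntegrableOn u (I ×ˢ J)) (hb : Continuous b)
    (hbD : ∀ x, ‖b x‖ ≤ D) : IntegrableOn (fun t => ∫ x in I, u (x, t) * b x) J := by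
  have h := integrableOn_mul_sep (c := fun _ => 1) (B := 1) hu hb hbD
    aestronglyMeasurable_const (by simp)
  rw [IntegrableOn, volume_restrict_prod] at h
  have h' := h.integral_prod_right
  simp only [one_mul] at h'
  exact h'

lemma integrableOn_mul_integral_sep (hu : IntegrableOn u (I ×ˢ J)) (hb : Continuous b)
    (hbD : ∀ x, ‖b x‖ ≤ D) (hc : AEStronglyMeasurable c (volume.restrict J))
    (hcB : ∀ᵐ t ∂(volume.restrict J), |c t| ≤ B) :
    IntegrableOn (fun t => c t * ∫ x in I, u (x, t) * b x) J :=
  (integrableOn_integral_mul hu hb hbD).bdd_mul hc hcB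

end Separated

/-! ### Energy inequality for the oscillation -/

section Energy

variable {z : ℝ × ℝ} {R : ℝ} {v g h : ℝ × ℝ → ℝ} {a : ℝ → ℝ}

/-- The weighted mean of a solution of the equation has a weak time derivative. -/
lemma integral_mean_mul_deriv (hv : IntegrableOn v (openCyl z R))
    (hg2 : IntegrableOn (fun p => g p ^ 2) (openCyl z R))
    (heq : ∀ φ : ℝ × ℝ → ℝ, IsTest (openCyl z R) φ →
      ∫ p in openCyl z R, (v p * (dt φ p - dx 4 φ p) - g p ^ 2 * dx 2 φ p) = 0)
    (ha : ContDiff ℝ ∞ a) (hac : HasCompactSupport a) (has : tsupport a ⊆ spaceI z R)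
    {θ : ℝ → ℝ} (hθ : ContDiff ℝ ∞ θ) (hθc : HasCompactSupport θ) (hθs : tsupport θ ⊆ timeI z R) :
    ∫ t in timeI z R, (∫ x in spaceI z R, v (x, t) * a x) * deriv θ t =
      -∫ t in timeI z R, -((∫ x in spaceI z R, v (x, t) * iteratedDeriv 4 a x) +
        ∫ x in spaceI z R, g (x, t) ^ 2 * iteratedDeriv 2 a x) * θ t := by
  have h0 := heq _ (isTest_mul ha hac has hθ hθc hθs)
  simp only [dx_mul, dt_mul] at h0
  obtain ⟨D0, hD0⟩ := exists_bound_iteratedDeriv ha hac 0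
  obtain ⟨D2, hD2⟩ := exists_bound_iteratedDeriv ha hac 2
  obtain ⟨D4, hD4⟩ := exists_bound_iteratedDeriv ha hac 4
  simp only [iteratedDeriv_zero] at hD0
  have c2 := (contDiff_iteratedDeriv ha 2).continuous
  have c4 := (contDiff_iteratedDeriv ha 4).continuous
  obtain ⟨B, hB⟩ := hθc.exists_bound_of_continuous hθ.continuous
  have hθ' := (contDiff_infty_iff_deriv.1 hθ).2.continuous
  obtain ⟨B', hB'⟩ := hθc.deriv.exists_bound_of_continuous hθ'
  have mθ := hθ.continuous.aestronglyMeasurable (μ := volume.restrict (timeI z R))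
  have mθ' := hθ'.aestronglyMeasurable (μ := volume.restrict (timeI z R))
  have bθ : ∀ᵐ t ∂(volume.restrict (timeI z R)), |θ t| ≤ B := Filter.Eventually.of_forall hB
  have bθ' : ∀ᵐ t ∂(volume.restrict (timeI z R)), |deriv θ t| ≤ B' :=
    Filter.Eventually.of_forall hB'
  have e1 := integral_mul_sep hv ha.continuous hD0 mθ' bθ'
  have e2 := integral_mul_sep hv c4 hD4 mθ bθ
  have e3 := integral_mul_sep hg2 c2 hD2 mθ bθ
  have i1 := integrableOn_mul_sep hv ha.continuous hD0 mθ' bθ'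
  have i2 := integrableOn_mul_sep hv c4 hD4 mθ bθ
  have i3 := integrableOn_mul_sep hg2 c2 hD2 mθ bθ
  have j2 := (integrableOn_integral_mul hv c4 hD4).bdd_mul mθ bθ
  have j3 := (integrableOn_integral_mul hg2 c2 hD2).bdd_mul mθ bθ
  have s1 := integral_sub (i1.sub i2) i3
  have s2 := integral_sub i1 i2
  have s3 := integral_add j2 j3
  simp only [Pi.sub_apply, ← mul_sub] at s1 s2
  rw [openCyl] at h0
  rw [h0] at s1
  rw [← integral_neg]
  have e4 : ∀ t, -(-((∫ x in spaceI z R, v (x, t) * iteratedDeriv 4 a x) +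
        ∫ x in spaceI z R, g (x, t) ^ 2 * iteratedDeriv 2 a x) * θ t) =
      θ t * (∫ x in spaceI z R, v (x, t) * iteratedDeriv 4 a x) +
        θ t * ∫ x in spaceI z R, g (x, t) ^ 2 * iteratedDeriv 2 a x := fun t => by ring
  simp only [e4]
  rw [s3, ← e2, ← e3]
  simp only [mul_comm _ (deriv θ _)]
  rw [← e1]
  linarith

/-- The local energy inequality for the oscillation of a suitable weak solution: all terms which
contain the mean cancel. -/
lemma ae_hat_energy_le (hR : 0 < R) (hv : MemLpq 2 ⊤ z R v)
    (hg2 : IntegrableOn (fun p => g p ^ 2) (openCyl z R))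
    (hg3 : IntegrableOn (fun p => g p ^ 3) (openCyl z R))
    (heq : ∀ φ : ℝ × ℝ → ℝ, IsTest (openCyl z R) φ →
      ∫ p in openCyl z R, (v p * (dt φ p - dx 4 φ p) - g p ^ 2 * dx 2 φ p) = 0)
    (hen : ∀ φ : ℝ × ℝ → ℝ, IsCylTest z R φ → (∀ p ∈ cyl z R, 0 ≤ φ p) →
      ∀ᵐ t ∂(volume.restrict (timeI z R)),
        1 / 2 * (∫ x in spaceI z R, v (x, t) ^ 2 * φ (x, t)) +
            (∫ p in spaceI z R ×ˢ Ioo (z.2 - R ^ 4) t, h p ^ 2 * φ p) ≤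
          ∫ p in spaceI z R ×ˢ Ioo (z.2 - R ^ 4) t,
            (1 / 2 * (dt φ p - dx 4 φ p) * v p ^ 2 + 2 * g p ^ 2 * dx 2 φ p
              - 5 / 3 * g p ^ 3 * dx 1 φ p - g p ^ 2 * v p * dx 2 φ p))
    (ha : ContDiff ℝ ∞ a) (hac : HasCompactSupport a) (has : tsupport a ⊆ spaceI z R)
    (ha0 : ∀ x, 0 ≤ a x) (hΦ : 0 < ∫ x, a x) {m : ℝ → ℝ}
    (hm : ∀ t, m t = (∫ x in spaceI z R, v (x, t) * a x) * (∫ x, a x)⁻¹)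
    (hgw : IntegrableOn (fun p => g p ^ 2 * (v p - m p.2)) (openCyl z R))
    {θ : ℝ → ℝ} (hθ : ContDiff ℝ ∞ θ) (hθc : HasCompactSupport θ)
    (hθs : tsupport θ ⊆ Ioi (z.2 - R ^ 4)) (hθ0 : ∀ t, 0 ≤ θ t) :
    ∀ᵐ t ∂(volume.restrict (timeI z R)),
      1 / 2 * (θ t * ∫ x in spaceI z R, (v (x, t) - m t) ^ 2 * a x) +
          (∫ p in spaceI z R ×ˢ Ioo (z.2 - R ^ 4) t, h p ^ 2 * (θ p.2 * a p.1)) ≤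
        ∫ p in spaceI z R ×ˢ Ioo (z.2 - R ^ 4) t,
          (1 / 2 * (deriv θ p.2 * a p.1 - θ p.2 * iteratedDeriv 4 a p.1) * (v p - m p.2) ^ 2
            + 2 * g p ^ 2 * (θ p.2 * iteratedDeriv 2 a p.1)
            - 5 / 3 * g p ^ 3 * (θ p.2 * iteratedDeriv 1 a p.1)
            - g p ^ 2 * (v p - m p.2) * (θ p.2 * iteratedDeriv 2 a p.1)) := by
  set Φ := ∫ x, a x with hΦdef
  have hστ : z.2 - R ^ 4 < z.2 := by linarith [pow_pos hR 4]
  have hv2 := hv.memLp_two_of_top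
  have hvI : IntegrableOn v (openCyl z R) := hv2.integrable (by norm_num)
  have hvsq : IntegrableOn (fun p => v p ^ 2) (openCyl z R) := hv2.integrable_sq
  obtain ⟨D0, hD0⟩ := exists_bound_iteratedDeriv ha hac 0
  obtain ⟨D1, hD1⟩ := exists_bound_iteratedDeriv ha hac 1
  obtain ⟨D2, hD2⟩ := exists_bound_iteratedDeriv ha hac 2
  obtain ⟨D4, hD4⟩ := exists_bound_iteratedDeriv ha hac 4
  simp only [iteratedDeriv_zero] at hD0
  have c0 := ha.continuous
  have c1 := (contDiff_iteratedDeriv ha 1).continuous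
  have c2 := (contDiff_iteratedDeriv ha 2).continuous
  have c4 := (contDiff_iteratedDeriv ha 4).continuous
  obtain ⟨B, hB⟩ := hθc.exists_bound_of_continuous hθ.continuous
  have hθ' := (contDiff_infty_iff_deriv.1 hθ).2.continuous
  obtain ⟨B', hB'⟩ := hθc.deriv.exists_bound_of_continuous hθ'
  have hMI : IntegrableOn (fun t => ∫ x in spaceI z R, v (x, t) * a x) (timeI z R) :=
    integrableOn_integral_mul hvI c0 hD0
  have hmI : IntegrableOn m (timeI z R) := by
    rw [funext hm]; exact hMI.mul_const _
  obtain ⟨Bm, hBm⟩ : ∃ Bm, ∀ᵐ t ∂(volume.restrict (timeI z R)), |m t| ≤ Bm := by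
    obtain ⟨B1, hB1⟩ := hv.exists_bound_integral hD0
    refine ⟨B1 * |Φ⁻¹|, ?_⟩
    filter_upwards [hB1] with t ht
    rw [hm, abs_mul]
    gcongr
  have hmM : ∀ t, ∫ x in spaceI z R, v (x, t) * a x = m t * Φ := by
    intro t
    rw [hm, mul_assoc, inv_mul_cancel₀ hΦ.ne', mul_one]
  have hθz : θ (z.2 - R ^ 4) = 0 := by
    by_contra h0
    have h1 := hθs (subset_tsupport _ h0)
    exact lt_irrefl _ (mem_Ioi.1 h1)
  set N : ℝ → ℝ := fun t => (∫ x in spaceI z R, v (x, t) * iteratedDeriv 4 a x) +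
        ∫ x in spaceI z R, g (x, t) ^ 2 * iteratedDeriv 2 a x with hN
  have hNI : IntegrableOn (fun t => -N t) (timeI z R) :=
    ((integrableOn_integral_mul hvI c4 hD4).add (integrableOn_integral_mul hg2 c2 hD2)).neg
  -- Balance of `θ M²` for `M = m Φ`, whose weak derivative is `-N`; there is no initial term
  -- because `θ` vanishes at time `z.2 - R ^ 4`.
  have bal := ae_mul_sq_eq_integral hστ hMI hNI
    (fun θ h1 h2 h3 => integral_mean_mul_deriv hvI hg2 heq ha hac has h1 h2 h3) hθ hθz
  have en := hen (fun p => θ p.2 * a p.1) (isTest_mul ha hac has hθ hθc hθs)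
    (fun p _ => mul_nonneg (hθ0 _) (ha0 _))
  have sl1 : ∀ᵐ t ∂(volume.restrict (timeI z R)),
      IntegrableOn (fun x => v (x, t)) (spaceI z R) := by
    have := hvI
    rw [IntegrableOn, volume_restrict_openCyl] at this
    exact this.prod_left_ae
  have sl2 : ∀ᵐ t ∂(volume.restrict (timeI z R)),
      IntegrableOn (fun x => v (x, t) ^ 2) (spaceI z R) := by
    have := hvsq
    rw [IntegrableOn, volume_restrict_openCyl] at this
    exact this.prod_left_ae
  filter_upwards [bal, en, sl1, sl2, self_mem_ae_restrict measurableSet_Ioo]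
    with t hbal hent hsl1 hsl2 htI
  simp only [dx_mul, dt_mul] at hent
  have ba : ∀ {u : ℝ → ℝ}, IntegrableOn u (spaceI z R) →
      IntegrableOn (fun x => u x * a x) (spaceI z R) := fun hu =>
    hu.mul_bdd c0.aestronglyMeasurable (Filter.Eventually.of_forall hD0)
  have haI : IntegrableOn a (spaceI z R) := (c0.integrable_of_hasCompactSupport hac).integrableOn
  -- the slice term
  have lhs : ∫ x in spaceI z R, v (x, t) ^ 2 * (θ t * a x) =
      θ t * (∫ x in spaceI z R, (v (x, t) - m t) ^ 2 * a x) + θ t * m t ^ 2 * Φ := by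
    have e : ∀ x, (v (x, t) - m t) ^ 2 * a x =
        v (x, t) ^ 2 * a x - 2 * m t * (v (x, t) * a x) + m t ^ 2 * a x := fun x => by ring
    have s1 := integral_add ((ba hsl2).sub ((ba hsl1).const_mul (2 * m t)))
      (haI.const_mul (m t ^ 2))
    have s2 := integral_sub (ba hsl2) ((ba hsl1).const_mul (2 * m t))
    simp only [Pi.sub_apply] at s1
    simp only [e]
    rw [s1, s2, integral_const_mul, integral_const_mul, hmM, setIntegral_eq_of_tsupport_subset has,
      ← hΦdef]
    have e2 : ∀ x, v (x, t) ^ 2 * (θ t * a x) = θ t * (v (x, t) ^ 2 * a x) := fun x => by ring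
    simp only [e2]
    rw [integral_const_mul]
    ring
  have hJ : Ioo (z.2 - R ^ 4) t ⊆ timeI z R := Ioo_subset_Ioo_right htI.2.le
  have hQt : spaceI z R ×ˢ Ioo (z.2 - R ^ 4) t ⊆ openCyl z R := prod_mono le_rfl hJ
  set J := Ioo (z.2 - R ^ 4) t with hJdef
  have mm : AEStronglyMeasurable m (volume.restrict J) :=
    hmI.aestronglyMeasurable.mono_measure (Measure.restrict_mono hJ le_rfl)
  have bm : ∀ᵐ s ∂(volume.restrict J), |m s| ≤ Bm := ae_restrict_of_ae_restrict_of_subset hJ hBm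
  have mθ := hθ.continuous.aestronglyMeasurable (μ := volume.restrict J)
  have mθ' := hθ'.aestronglyMeasurable (μ := volume.restrict J)
  have bθ : ∀ᵐ t ∂(volume.restrict J), |θ t| ≤ B := Filter.Eventually.of_forall hB
  have bθ' : ∀ᵐ t ∂(volume.restrict J), |deriv θ t| ≤ B' := Filter.Eventually.of_forall hB'
  have bmul : ∀ {c d : ℝ → ℝ} {C D : ℝ}, (∀ᵐ t ∂(volume.restrict J), |c t| ≤ C) →
      (∀ᵐ t ∂(volume.restrict J), |d t| ≤ D) →
      ∀ᵐ t ∂(volume.restrict J), |(c * d) t| ≤ C * D := by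
    intro c d C D hc hd
    filter_upwards [hc, hd] with s h1 h2
    rw [Pi.mul_apply, abs_mul]
    exact mul_le_mul h1 h2 (abs_nonneg _) ((abs_nonneg _).trans h1)
  have one : IntegrableOn (fun _ : ℝ × ℝ => (1 : ℝ)) (spaceI z R ×ˢ J) :=
    (integrableOn_const (C := (1 : ℝ)) (by
      have := (inferInstance : IsFiniteMeasure (volume.restrict (openCyl z R)))
      rw [← Measure.restrict_apply_univ]
      exact (measure_lt_top _ _).ne) : IntegrableOn _ (openCyl z R)).mono_set hQt
  have vJ := hvI.mono_set hQt
  have gJ := hg2.mono_set hQt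
  -- the terms containing the mean
  have m1 := mθ'.mul mm
  have b1 := bmul bθ' bm
  have m2 := mθ'.mul (mm.mul mm)
  have b2 := bmul bθ' (bmul bm bm)
  have m3 := mθ.mul mm
  have b3 := bmul bθ bm
  have m4 := mθ.mul (mm.mul mm)
  have b4 := bmul bθ (bmul bm bm)
  have iD1 := integrableOn_mul_sep vJ c0 hD0 m1 b1
  have iD2 := integrableOn_mul_sep one c0 hD0 m2 b2
  have iD3 := integrableOn_mul_sep vJ c4 hD4 m3 b3
  have iD4 := integrableOn_mul_sep one c4 hD4 m4 b4
  have iD5 := integrableOn_mul_sep gJ c2 hD2 m3 b3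
  have eD1 := integral_mul_sep vJ c0 hD0 m1 b1
  have eD2 := integral_mul_sep one c0 hD0 m2 b2
  have eD3 := integral_mul_sep vJ c4 hD4 m3 b3
  have eD4 := integral_mul_sep one c4 hD4 m4 b4
  have eD5 := integral_mul_sep gJ c2 hD2 m3 b3
  have kD1 := integrableOn_mul_integral_sep vJ c0 hD0 m1 b1
  have kD2 := integrableOn_mul_integral_sep one c0 hD0 m2 b2
  have kD3 := integrableOn_mul_integral_sep vJ c4 hD4 m3 b3
  have kD4 := integrableOn_mul_integral_sep one c4 hD4 m4 b4
  have kD5 := integrableOn_mul_integral_sep gJ c2 hD2 m3 b3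
  -- The integrand is the difference of the right-hand integrands for `v` and for `v - m`, expanded
  -- by `v² - (v - m)² = 2 v m - m²`.
  have hD : (∫ p in spaceI z R ×ˢ J, (v p * ((deriv θ * m) p.2 * a p.1)
        - 1 / 2 * (1 * ((deriv θ * (m * m)) p.2 * a p.1))
        - v p * ((θ * m) p.2 * iteratedDeriv 4 a p.1)
        + 1 / 2 * (1 * ((θ * (m * m)) p.2 * iteratedDeriv 4 a p.1))
        - g p ^ 2 * ((θ * m) p.2 * iteratedDeriv 2 a p.1))) = 1 / 2 * (θ t * m t ^ 2 * Φ) := by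
    have s1 := integral_sub (((iD1.sub (iD2.const_mul (1 / 2))).sub iD3).add
      (iD4.const_mul (1 / 2))) iD5
    have s2 := integral_add ((iD1.sub (iD2.const_mul (1 / 2))).sub iD3) (iD4.const_mul (1 / 2))
    have s3 := integral_sub (iD1.sub (iD2.const_mul (1 / 2))) iD3
    have s4 := integral_sub iD1 (iD2.const_mul (1 / 2))
    have r1 := integral_sub (((kD1.sub (kD2.const_mul (1 / 2))).sub kD3).add
      (kD4.const_mul (1 / 2))) kD5
    have r2 := integral_add ((kD1.sub (kD2.const_mul (1 / 2))).sub kD3) (kD4.const_mul (1 / 2))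
    have r3 := integral_sub (kD1.sub (kD2.const_mul (1 / 2))) kD3
    have r4 := integral_sub kD1 (kD2.const_mul (1 / 2))
    simp only [Pi.sub_apply, Pi.add_apply] at s1 s2 s3 r1 r2 r3
    rw [integral_const_mul (1 / 2 : ℝ)] at s2 s4 r2 r4
    rw [s1, s2, s3, s4, eD1, eD2, eD3, eD4, eD5, ← r4, ← r3, ← r2, ← r1]
    -- After integration in space, the factor `2 Φ` turns the integrand into `θ' M² - 2 θ M N`, the
    -- one in `hbal`. The `m²` term with `a''''` vanishes because `∫ a'''' = 0`.
    refine mul_left_cancel₀ (mul_ne_zero two_ne_zero hΦ.ne') ?_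
    rw [← integral_const_mul]
    have e5 : 2 * Φ * (1 / 2 * (θ t * m t ^ 2 * Φ)) =
        θ t * (∫ x in spaceI z R, v (x, t) * a x) ^ 2 := by rw [hmM]; ring
    rw [e5, hbal]
    congr 1
    ext s
    have z4 : ∫ x in spaceI z R, iteratedDeriv 4 a x = 0 := by
      rw [setIntegral_eq_of_tsupport_subset ((tsupport_iteratedDeriv_subset a 4).trans has)]
      exact integral_iteratedDeriv_succ ha hac 3
    have z0 : ∫ x in spaceI z R, a x = Φ := setIntegral_eq_of_tsupport_subset has
    simp only [one_mul, z4, z0, hmM, Pi.mul_apply, hN]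
    ring
  have wJ : IntegrableOn (fun p => (v p - m p.2) ^ 2) (spaceI z R ×ˢ J) := by
    have e : ∀ p : ℝ × ℝ, (v p - m p.2) ^ 2 = v p ^ 2 - 2 * (v p * (m p.2 * 1)) +
        1 * ((m * m) p.2 * 1) := fun p => by simp only [Pi.mul_apply]; ring
    simp only [e]
    exact ((hvsq.mono_set hQt).sub ((integrableOn_mul_sep (b := fun _ => 1) (D := 1) vJ
      continuous_const (by simp) mm bm).const_mul 2)).add
      (integrableOn_mul_sep (b := fun _ => 1) (D := 1) one continuous_const (by simp)
        (mm.mul mm) (bmul bm bm))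
  have iX : IntegrableOn (fun p => 1 / 2 * (deriv θ p.2 * a p.1 - θ p.2 * iteratedDeriv 4 a p.1)
        * (v p - m p.2) ^ 2
        + 2 * g p ^ 2 * (θ p.2 * iteratedDeriv 2 a p.1)
        - 5 / 3 * g p ^ 3 * (θ p.2 * iteratedDeriv 1 a p.1)
        - g p ^ 2 * (v p - m p.2) * (θ p.2 * iteratedDeriv 2 a p.1)) (spaceI z R ×ˢ J) := by
    have x1 := integrableOn_mul_sep wJ c0 hD0 mθ' bθ'
    have x2 := integrableOn_mul_sep wJ c4 hD4 mθ bθ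
    have x3 := integrableOn_mul_sep gJ c2 hD2 mθ bθ
    have x4 := integrableOn_mul_sep (hg3.mono_set hQt) c1 hD1 mθ bθ
    have x5 := integrableOn_mul_sep (hgw.mono_set hQt) c2 hD2 mθ bθ
    refine (((((x1.sub x2).const_mul (1 / 2)).add (x3.const_mul 2)).sub
      (x4.const_mul (5 / 3))).sub x5).congr (Filter.Eventually.of_forall fun p => ?_)
    simp only [Pi.add_apply, Pi.sub_apply]
    ring
  have iD := (((iD1.sub (iD2.const_mul (1 / 2))).sub iD3).add (iD4.const_mul (1 / 2))).sub iD5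
  have sX := integral_add iX iD
  simp only [Pi.sub_apply, Pi.add_apply] at sX
  rw [hD] at sX
  rw [lhs] at hent
  -- The same quantity comes from the slice term on the left and from `hD` on the right.
  refine le_of_add_le_add_right (a := 1 / 2 * (θ t * m t ^ 2 * Φ)) ?_
  rw [← sX]
  have e6 : ∀ p : ℝ × ℝ, 1 / 2 * (deriv θ p.2 * a p.1 - θ p.2 * iteratedDeriv 4 a p.1) * v p ^ 2
        + 2 * g p ^ 2 * (θ p.2 * iteratedDeriv 2 a p.1)
        - 5 / 3 * g p ^ 3 * (θ p.2 * iteratedDeriv 1 a p.1)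
        - g p ^ 2 * v p * (θ p.2 * iteratedDeriv 2 a p.1) =
      1 / 2 * (deriv θ p.2 * a p.1 - θ p.2 * iteratedDeriv 4 a p.1) * (v p - m p.2) ^ 2
        + 2 * g p ^ 2 * (θ p.2 * iteratedDeriv 2 a p.1)
        - 5 / 3 * g p ^ 3 * (θ p.2 * iteratedDeriv 1 a p.1)
        - g p ^ 2 * (v p - m p.2) * (θ p.2 * iteratedDeriv 2 a p.1)
      + (v p * ((deriv θ * m) p.2 * a p.1)
        - 1 / 2 * (1 * ((deriv θ * (m * m)) p.2 * a p.1))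
        - v p * ((θ * m) p.2 * iteratedDeriv 4 a p.1)
        + 1 / 2 * (1 * ((θ * (m * m)) p.2 * iteratedDeriv 4 a p.1))
        - g p ^ 2 * ((θ * m) p.2 * iteratedDeriv 2 a p.1)) := fun p => by
    simp only [Pi.mul_apply]; ring
  simp only [e6] at hent
  linarith

end Energy

/-! ### Estimates of the right-hand side by the first derivative -/

section Slice

variable {μ : Measure ℝ} [IsFiniteMeasure μ] {f : ℝ → ℝ}

/-- Cauchy-Schwarz, read off from `0 ≤ ∫ (L |f| - A)²` with `L` the total mass and `A = ∫ |f|`. -/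
lemma sq_integral_abs_le (hL : 0 < μ.real univ) (hf : Integrable f μ)
    (hf2 : Integrable (fun x => f x ^ 2) μ) :
    (∫ x, |f x| ∂μ) ^ 2 ≤ μ.real univ * ∫ x, f x ^ 2 ∂μ := by
  set L := μ.real univ
  set A := ∫ x, |f x| ∂μ with hA
  have h0 : 0 ≤ ∫ x, (L * |f x| - A) ^ 2 ∂μ := integral_nonneg fun x => sq_nonneg _
  have e : ∀ x, (L * |f x| - A) ^ 2 = L ^ 2 * f x ^ 2 - 2 * L * A * |f x| + A ^ 2 := by
    intro x
    rw [← sq_abs (f x)]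
    ring
  have s1 := integral_add ((hf2.const_mul (L ^ 2)).sub (hf.abs.const_mul (2 * L * A)))
    (integrable_const (A ^ 2))
  have s2 := integral_sub (hf2.const_mul (L ^ 2)) (hf.abs.const_mul (2 * L * A))
  simp only [Pi.sub_apply] at s1
  simp only [e] at h0
  rw [s1, s2, integral_const_mul, integral_const_mul, integral_const, ← hA, smul_eq_mul] at h0
  change 0 ≤ L ^ 2 * _ - 2 * L * A * A + L * A ^ 2 at h0
  have h1 : 0 ≤ L * (L * (∫ x, f x ^ 2 ∂μ) - A ^ 2) := by nlinarith
  have := nonneg_of_mul_nonneg_right h1 hL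
  linarith

/-- Integrate the pointwise bound `b² |f| ≤ |f|³ + |b|³`, which follows by comparing `|f|` with
`|b|`. -/
lemma sq_mul_integral_abs_le (hf : Integrable f μ)
    (hf3 : Integrable (fun x => |f x| ^ 3) μ) (b : ℝ) :
    b ^ 2 * (∫ x, |f x| ∂μ) ≤ (∫ x, |f x| ^ 3 ∂μ) + μ.real univ * |b| ^ 3 := by
  have h : ∫ x, b ^ 2 * |f x| ∂μ ≤ ∫ x, (|f x| ^ 3 + |b| ^ 3) ∂μ := by
    refine integral_mono (hf.abs.const_mul _) (hf3.add (integrable_const _)) fun x => ?_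
    simp only
    rw [← sq_abs b]
    have h1 := abs_nonneg (f x)
    have h2 := abs_nonneg b
    rcases le_total |f x| |b| with h3 | h3
    · have : |b| ^ 2 * |f x| ≤ |b| ^ 2 * |b| := by gcongr
      nlinarith [pow_nonneg h1 3]
    · have : |b| ^ 2 * |f x| ≤ |f x| ^ 2 * |f x| := by gcongr
      nlinarith [pow_nonneg h2 3]
  rwa [integral_const_mul, integral_add hf3 (integrable_const _), integral_const,
    smul_eq_mul] at h

end Slice

section Cylinder

variable {z : ℝ × ℝ} {R : ℝ} {g w : ℝ × ℝ → ℝ}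

lemma real_spaceI (hR : 0 < R) : (volume.restrict (spaceI z R)).real univ = 2 * R := by
  rw [measureReal_restrict_apply_univ, spaceI, Real.volume_real_Ioo_of_le (by linarith)]
  ring

lemma integrableOn_slice_integral {u : ℝ × ℝ → ℝ} (hu : IntegrableOn u (openCyl z R)) :
    IntegrableOn (fun p : ℝ × ℝ => ∫ x in spaceI z R, u (x, p.2)) (openCyl z R) := by
  rw [IntegrableOn, volume_restrict_openCyl] at hu ⊢
  exact hu.integral_prod_right.comp_snd _

/-- A slice integral is constant in space, so integrating it again gains the length `2 R`, which
offsets a power of `1 / R` from the cut-offs. -/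
lemma integral_slice_integral (hR : 0 < R) {u : ℝ × ℝ → ℝ} (hu : IntegrableOn u (openCyl z R)) :
    ∫ p in openCyl z R, ∫ x in spaceI z R, u (x, p.2) = 2 * R * ∫ p in openCyl z R, u p := by
  have h := integrableOn_slice_integral hu
  rw [IntegrableOn, volume_restrict_openCyl] at hu h
  rw [volume_restrict_openCyl, integral_prod_symm _ hu, integral_prod_symm _ h,
    ← integral_const_mul]
  congr 1; ext t
  simp only [integral_const, real_spaceI hR, smul_eq_mul]

lemma ae_oscillation_bounds (hR : 0 < R) (hgI : IntegrableOn g (openCyl z R))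
    (hg2 : IntegrableOn (fun p => g p ^ 2) (openCyl z R))
    (hg3 : IntegrableOn (fun p => |g p| ^ 3) (openCyl z R))
    (hw : ∀ᵐ p ∂(volume.restrict (openCyl z R)), |w p| ≤ ∫ x in spaceI z R, |g (x, p.2)|) :
    ∀ᵐ p ∂(volume.restrict (openCyl z R)),
      w p ^ 2 ≤ 2 * R * (∫ x in spaceI z R, g (x, p.2) ^ 2) ∧
      g p ^ 2 * |w p| ≤ (∫ x in spaceI z R, |g (x, p.2)| ^ 3) + 2 * R * |g p| ^ 3 := by
  have sl : ∀ {u : ℝ × ℝ → ℝ}, IntegrableOn u (openCyl z R) →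
      ∀ᵐ p ∂(volume.restrict (openCyl z R)),
        Integrable (fun x => u (x, p.2)) (volume.restrict (spaceI z R)) := by
    intro u hu
    rw [IntegrableOn, volume_restrict_openCyl] at hu
    rw [volume_restrict_openCyl]
    exact Measure.quasiMeasurePreserving_snd.ae hu.prod_left_ae
  filter_upwards [hw, sl hgI, sl hg2, sl hg3] with p hp h1 h2 h3
  have hL := real_spaceI (z := z) hR
  constructor
  · have := sq_integral_abs_le (by rw [hL]; linarith) h1 h2
    rw [hL] at this
    refine le_trans ?_ this
    rw [← sq_abs (w p)]
    gcongr
  · have := sq_mul_integral_abs_le h1 h3 (g p)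
    rw [hL] at this
    exact (mul_le_mul_of_nonneg_left hp (sq_nonneg _)).trans this

/-- Here `b0` stands for the time derivative of the cut-off and `b1`, `b2`, `b4` for its space
derivatives. The bound of `w` by a slice integral of `|g|` gives every quadratic term the scale
`R⁻²` and every cubic term the scale `R⁻¹`. -/
lemma abs_energy_integral_le (hR : 0 < R) {K : ℝ} (hK : 0 ≤ K)
    (hgI : IntegrableOn g (openCyl z R))
    (hg2 : IntegrableOn (fun p => g p ^ 2) (openCyl z R))
    (hg3 : IntegrableOn (fun p => |g p| ^ 3) (openCyl z R))
    (hw : ∀ᵐ p ∂(volume.restrict (openCyl z R)), |w p| ≤ ∫ x in spaceI z R, |g (x, p.2)|)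
    {b0 b1 b2 b4 : ℝ × ℝ → ℝ}
    (h0 : ∀ p ∈ openCyl z R, |b0 p| ≤ K / R ^ 4) (h1 : ∀ p ∈ openCyl z R, |b1 p| ≤ K / R)
    (h2 : ∀ p ∈ openCyl z R, |b2 p| ≤ K / R ^ 2) (h4 : ∀ p ∈ openCyl z R, |b4 p| ≤ K / R ^ 4)
    {t : ℝ} (ht : t ∈ timeI z R) :
    ∫ p in spaceI z R ×ˢ Ioo (z.2 - R ^ 4) t, (1 / 2 * (b0 p - b4 p) * w p ^ 2
        + 2 * g p ^ 2 * b2 p - 5 / 3 * g p ^ 3 * b1 p - g p ^ 2 * w p * b2 p) ≤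
      6 * K / R ^ 2 * (∫ p in openCyl z R, g p ^ 2) +
        6 * K / R * ∫ p in openCyl z R, |g p| ^ 3 := by
  have hQt : spaceI z R ×ˢ Ioo (z.2 - R ^ 4) t ⊆ openCyl z R :=
    prod_mono le_rfl (Ioo_subset_Ioo_right ht.2.le)
  have i2 := integrableOn_slice_integral hg2
  have i3 := integrableOn_slice_integral hg3
  have y1 := i2.const_mul (K / R ^ 4 * (2 * R))
  have y2 := hg2.const_mul (2 * (K / R ^ 2))
  have y3 := hg3.const_mul (5 / 3 * (K / R) + K / R ^ 2 * (2 * R))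
  have y4 := i3.const_mul (K / R ^ 2)
  -- A nonnegative majorant of the integrand; nonnegativity permits enlarging the domain from times
  -- before `t` to the whole cylinder.
  set Y : ℝ × ℝ → ℝ := fun p =>
    K / R ^ 4 * (2 * R) * (∫ x in spaceI z R, g (x, p.2) ^ 2) + 2 * (K / R ^ 2) * g p ^ 2
      + (5 / 3 * (K / R) + K / R ^ 2 * (2 * R)) * |g p| ^ 3
      + K / R ^ 2 * ∫ x in spaceI z R, |g (x, p.2)| ^ 3 with hY
  have hYI : IntegrableOn Y (openCyl z R) := ((y1.add y2).add y3).add y4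
  have hY0 : ∀ p, 0 ≤ Y p := by
    intro p
    have a1 : 0 ≤ ∫ x in spaceI z R, g (x, p.2) ^ 2 := integral_nonneg fun x => sq_nonneg _
    have a2 : 0 ≤ ∫ x in spaceI z R, |g (x, p.2)| ^ 3 := integral_nonneg fun x => by positivity
    simp only [hY]
    positivity
  -- Quadratic terms: `4 + 2 = 6`. Cubic terms: `5/3 + 2 + 2 = 17/3`, rounded up to `6` below.
  have hYv : ∫ p in openCyl z R, Y p = 6 * K / R ^ 2 * (∫ p in openCyl z R, g p ^ 2) +
      (17 / 3) * K / R * ∫ p in openCyl z R, |g p| ^ 3 := by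
    have s1 := integral_add ((y1.add y2).add y3) y4
    have s2 := integral_add (y1.add y2) y3
    have s3 := integral_add y1 y2
    simp only [Pi.add_apply] at s1 s2
    refine s1.trans ?_
    rw [s2, s3, integral_const_mul, integral_const_mul, integral_const_mul, integral_const_mul,
      integral_slice_integral hR hg2, integral_slice_integral hR hg3]
    field_simp
    ring
  have bound : ‖∫ p in spaceI z R ×ˢ Ioo (z.2 - R ^ 4) t, (1 / 2 * (b0 p - b4 p) * w p ^ 2
        + 2 * g p ^ 2 * b2 p - 5 / 3 * g p ^ 3 * b1 p - g p ^ 2 * w p * b2 p)‖ ≤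
      ∫ p in spaceI z R ×ˢ Ioo (z.2 - R ^ 4) t, Y p := by
    refine norm_integral_le_of_norm_le (hYI.mono_set hQt) ?_
    refine ae_restrict_of_ae_restrict_of_subset hQt ?_
    filter_upwards [ae_oscillation_bounds hR hgI hg2 hg3 hw,
      self_mem_ae_restrict (isOpen_openCyl z R).measurableSet] with p hp hpQ
    have q0 := h0 p hpQ
    have q1 := h1 p hpQ
    have q2 := h2 p hpQ
    have q4 := h4 p hpQ
    have t1 : |1 / 2 * (b0 p - b4 p) * w p ^ 2| ≤
        K / R ^ 4 * (2 * R * ∫ x in spaceI z R, g (x, p.2) ^ 2) := by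
      rw [abs_mul, abs_of_nonneg (sq_nonneg (w p))]
      refine mul_le_mul ?_ hp.1 (sq_nonneg _) (by positivity)
      rw [abs_mul, abs_of_pos (by norm_num : (0 : ℝ) < 1 / 2)]
      have := abs_sub (b0 p) (b4 p)
      linarith
    have t2 : |2 * g p ^ 2 * b2 p| ≤ 2 * g p ^ 2 * (K / R ^ 2) := by
      rw [abs_mul, abs_of_nonneg (by positivity : 0 ≤ 2 * g p ^ 2)]
      gcongr
    have t3 : |5 / 3 * g p ^ 3 * b1 p| ≤ 5 / 3 * |g p| ^ 3 * (K / R) := by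
      rw [abs_mul, abs_mul, abs_pow, abs_of_pos (by norm_num : (0 : ℝ) < 5 / 3)]
      gcongr
    have t4 : |g p ^ 2 * w p * b2 p| ≤
        ((∫ x in spaceI z R, |g (x, p.2)| ^ 3) + 2 * R * |g p| ^ 3) * (K / R ^ 2) := by
      rw [abs_mul, abs_mul, abs_of_nonneg (sq_nonneg (g p))]
      exact mul_le_mul hp.2 q2 (abs_nonneg _)
        ((mul_nonneg (sq_nonneg _) (abs_nonneg _)).trans hp.2)
    rw [Real.norm_eq_abs]
    have u1 := abs_sub (1 / 2 * (b0 p - b4 p) * w p ^ 2 + 2 * g p ^ 2 * b2 p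
      - 5 / 3 * g p ^ 3 * b1 p) (g p ^ 2 * w p * b2 p)
    have u2 := abs_sub (1 / 2 * (b0 p - b4 p) * w p ^ 2 + 2 * g p ^ 2 * b2 p)
      (5 / 3 * g p ^ 3 * b1 p)
    have u3 := abs_add_le (1 / 2 * (b0 p - b4 p) * w p ^ 2) (2 * g p ^ 2 * b2 p)
    simp only [hY]
    linarith
  refine (le_abs_self _).trans (bound.trans ?_)
  refine (setIntegral_mono_set hYI (Filter.Eventually.of_forall hY0) hQt.eventuallyLE).trans ?_
  rw [hYv]
  have e3 : 0 ≤ ∫ p in openCyl z R, |g p| ^ 3 := integral_nonneg fun p => by positivity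
  have : (17 / 3) * K / R ≤ 6 * K / R := by gcongr; norm_num
  nlinarith

end Cylinder

/-! ### Temporal cut-offs and their approximations -/

section TimeCut

variable {χ₀ : ℝ → ℝ}

/-- Compactness handles `[-1, 0]`; outside this interval `χ₀` is locally constant with values `0`
and `1`. -/
lemma IsTimeCutoff.exists_bound (h : IsTimeCutoff χ₀) :
    ∃ K, 0 ≤ K ∧ (∀ s, |χ₀ s| ≤ K) ∧ ∀ s, |deriv χ₀ s| ≤ K := by
  obtain ⟨K1, hK1⟩ := isCompact_Icc.exists_bound_of_continuousOn (s := Icc (-1 : ℝ) 0)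
    h.1.continuous.continuousOn
  have hd := (contDiff_infty_iff_deriv.1 h.1).2
  obtain ⟨K2, hK2⟩ := isCompact_Icc.exists_bound_of_continuousOn (s := Icc (-1 : ℝ) 0)
    hd.continuous.continuousOn
  refine ⟨max (max K1 K2) 1, by positivity, fun s => ?_, fun s => ?_⟩
  · by_cases hs : s ∈ Icc (-1 : ℝ) 0
    · exact (hK1 s hs).trans ((le_max_left _ _).trans (le_max_left _ _))
    · rw [mem_Icc, not_and_or, not_le, not_le] at hs
      rcases hs with hs | hs
      · rw [h.2.2.1 s hs.le]
        simp
      · rw [h.2.2.2 s (by linarith)]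
        simp
  · by_cases hs : s ∈ Icc (-1 : ℝ) 0
    · exact (hK2 s hs).trans ((le_max_right _ _).trans (le_max_left _ _))
    · have : deriv χ₀ s = 0 := by
        rw [mem_Icc, not_and_or, not_le, not_le] at hs
        rcases hs with hs | hs
        · have e : χ₀ =ᶠ[nhds s] fun _ => 0 := by
            filter_upwards [Iio_mem_nhds hs] with r hr using h.2.2.1 r (le_of_lt hr)
          rw [e.deriv_eq, deriv_const]
        · have e : χ₀ =ᶠ[nhds s] fun _ => 1 := by
            filter_upwards [Ioi_mem_nhds hs] with r hr using
              h.2.2.2 r (by linarith [mem_Ioi.1 hr])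
          rw [e.deriv_eq, deriv_const]
      rw [this]
      simp

/-- Compactly supported approximations of the temporal cut-off. -/
noncomputable def shiftedTimeCut (χ₀ : ℝ → ℝ) (z : ℝ × ℝ) (R ε t : ℝ) : ℝ :=
  χ₀ ((t - z.2) / R ^ 4 - ε) * (1 - Real.smoothTransition ((t - z.2) / R ^ 4))

variable (h : IsTimeCutoff χ₀) (z : ℝ × ℝ) {R ε : ℝ} (hR : 0 < R) (hε : 0 < ε)
include h

lemma contDiff_shiftedTimeCut (R ε : ℝ) : ContDiff ℝ ∞ (shiftedTimeCut χ₀ z R ε) := by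
  refine (h.1.comp ?_).mul (contDiff_const.sub (Real.smoothTransition.contDiff.comp ?_))
  · exact ((contDiff_id.sub contDiff_const).div_const _).sub contDiff_const
  · exact (contDiff_id.sub contDiff_const).div_const _

lemma shiftedTimeCut_nonneg (R ε t : ℝ) : 0 ≤ shiftedTimeCut χ₀ z R ε t :=
  mul_nonneg (h.2.1 _) (sub_nonneg.2 (Real.smoothTransition.le_one _))

include hR in
-- The shift by `ε` moves the support away from the initial time, which the support of `χ₀` itself
-- may touch. The smooth-transition factor cuts off the future and equals one up to the final time,
-- so nothing changes on the cylinder.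
lemma support_shiftedTimeCut_subset : Function.support (shiftedTimeCut χ₀ z R ε) ⊆
    Icc (z.2 - R ^ 4 + ε * R ^ 4) (z.2 + R ^ 4) := by
  have hR4 := pow_pos hR 4
  intro t ht
  have h1 : χ₀ ((t - z.2) / R ^ 4 - ε) ≠ 0 := left_ne_zero_of_mul ht
  have h2 : 1 - Real.smoothTransition ((t - z.2) / R ^ 4) ≠ 0 := right_ne_zero_of_mul ht
  constructor
  · by_contra hc
    refine h1 (h.2.2.1 _ ?_)
    rw [sub_le_iff_le_add, div_le_iff₀ hR4]
    nlinarith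
  · by_contra hc
    refine h2 ?_
    rw [Real.smoothTransition.one_of_one_le, sub_self]
    rw [le_div_iff₀ hR4]
    linarith

include hR in
lemma hasCompactSupport_shiftedTimeCut : HasCompactSupport (shiftedTimeCut χ₀ z R ε) :=
  HasCompactSupport.of_support_subset_isCompact isCompact_Icc
    (support_shiftedTimeCut_subset h z hR)

include hR hε in
lemma tsupport_shiftedTimeCut_subset :
    tsupport (shiftedTimeCut χ₀ z R ε) ⊆ Ioi (z.2 - R ^ 4) := by
  refine (closure_minimal (support_shiftedTimeCut_subset h z hR) isClosed_Icc).trans ?_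
  intro t ht
  have := mul_pos hε (pow_pos hR 4)
  exact lt_of_lt_of_le (by linarith) ht.1

omit h in
include hR in
lemma shiftedTimeCut_eq {t : ℝ} (ht : t < z.2) :
    shiftedTimeCut χ₀ z R ε t = χ₀ ((t - z.2) / R ^ 4 - ε) := by
  rw [shiftedTimeCut, Real.smoothTransition.zero_of_nonpos, sub_zero, mul_one]
  exact div_nonpos_of_nonpos_of_nonneg (by linarith) (pow_pos hR 4).le

include hR in
lemma deriv_shiftedTimeCut_eq {t : ℝ} (ht : t < z.2) :
    deriv (shiftedTimeCut χ₀ z R ε) t = deriv χ₀ ((t - z.2) / R ^ 4 - ε) * (R ^ 4)⁻¹ := by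
  have e : shiftedTimeCut χ₀ z R ε =ᶠ[nhds t] fun s => χ₀ ((s - z.2) / R ^ 4 - ε) := by
    filter_upwards [Iio_mem_nhds ht] with s hs using shiftedTimeCut_eq z hR hs
  rw [e.deriv_eq]
  have h1 : HasDerivAt (fun s : ℝ => (s - z.2) / R ^ 4 - ε) (1 / R ^ 4) t :=
    (((hasDerivAt_id t).sub_const z.2).div_const (R ^ 4)).sub_const ε
  have h2 := (h.1.differentiable (by simp) ((t - z.2) / R ^ 4 - ε)).hasDerivAt
  rw [← one_div]
  exact (h2.comp t h1).deriv

include hR in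
lemma tendsto_shiftedTimeCut {t : ℝ} (ht : t < z.2) :
    Filter.Tendsto (fun n : ℕ => shiftedTimeCut χ₀ z R (1 / ((n : ℝ) + 1)) t) Filter.atTop
      (nhds (timeCut χ₀ z R t)) := by
  simp only [shiftedTimeCut_eq z hR ht, timeCut]
  refine (h.1.continuous.tendsto _).comp ?_
  have := (tendsto_one_div_add_atTop_nhds_zero_nat (𝕜 := ℝ)).const_sub ((t - z.2) / R ^ 4)
  simpa using this

end TimeCut

/-- A set of full measure is dense. This is used to approach the final time, and later an arbitrary
time, through times at which the energy bound holds. -/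
lemma exists_seq_tendsto_of_ae {σ τ s : ℝ} (hστ : σ < τ) (hs : s ∈ Icc σ τ) {P : ℝ → Prop}
    (hP : ∀ᵐ t ∂(volume.restrict (Ioo σ τ)), P t) :
    ∃ u : ℕ → ℝ, (∀ n, u n ∈ Ioo σ τ ∧ P (u n)) ∧ Filter.Tendsto u Filter.atTop (nhds s) := by
  have : s ∈ closure {t | t ∈ Ioo σ τ ∧ P t} := by
    rw [mem_closure_iff]
    intro o ho hso
    have hs' : s ∈ closure (Ioo σ τ) := by rwa [closure_Ioo hστ.ne]
    have hne := mem_closure_iff.1 hs' o ho hso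
    by_contra hcon
    rw [ae_restrict_iff' measurableSet_Ioo] at hP
    have h0 : volume (o ∩ Ioo σ τ) = 0 := by
      refine measure_mono_null ?_ hP
      intro t ht hc
      exact hcon ⟨t, ht.1, ht.2, hc ht.2⟩
    exact (ho.inter isOpen_Ioo).measure_ne_zero volume hne h0
  obtain ⟨u, hu, hlim⟩ := mem_closure_iff_seq_limit.1 this
  exact ⟨u, hu, hlim⟩

lemma volume_restrict_cyl (z : ℝ × ℝ) (R : ℝ) :
    (volume : Measure (ℝ × ℝ)).restrict (cyl z R) = volume.restrict (openCyl z R) := by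
  rw [volume_restrict_openCyl, cyl, volume_restrict_prod, timeI,
    Measure.restrict_congr_set Ioo_ae_eq_Ioc]

/-! ### Energy bound for the approximate cut-offs -/

section Main

variable {φ₀ χ₀ : ℝ → ℝ} {z : ℝ × ℝ} {R : ℝ} {v g h : ℝ × ℝ → ℝ}

lemma hasWeakDx_hat {k : ℕ} (hφ₀ : IsSpaceCutoff φ₀) (hR : 0 < R) (hv : MemLpq 2 ⊤ z R v)
    (hg : HasWeakDx (k + 1) z R v g) : HasWeakDx (k + 1) z R (hat φ₀ z R v) g := by
  have hvI : IntegrableOn v (openCyl z R) := hv.memLp_two_of_top.integrable (by norm_num)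
  obtain ⟨D, hD⟩ := (hasCompactSupport_spaceCut hφ₀ z hR).exists_bound_of_continuous
    (contDiff_spaceCut hφ₀ z R).continuous
  exact hg.sub_time hvI (m := fun t => wmean φ₀ z R fun x => v (x, t))
    ((integrableOn_integral_mul hvI (contDiff_spaceCut hφ₀ z R).continuous hD).mul_const _)

lemma ae_abs_hat_le (hφ₀ : IsSpaceCutoff φ₀) (hR : 0 < R) (hv : MemLpq 2 ⊤ z R v)
    (hg : HasWeakDx 1 z R v g) (hgI : IntegrableOn g (openCyl z R)) :
    ∀ᵐ p ∂(volume.restrict (openCyl z R)),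
      |hat φ₀ z R v p| ≤ ∫ x in spaceI z R, |g (x, p.2)| := by
  have hvI : IntegrableOn v (openCyl z R) := hv.memLp_two_of_top.integrable (by norm_num)
  have := ae_abs_sub_mean_le (α := z.1 - R) (β := z.1 + R) (by linarith) (J := timeI z R)
    isOpen_Ioo (contDiff_spaceCut hφ₀ z R) (hasCompactSupport_spaceCut hφ₀ z hR)
    (tsupport_spaceCut_subset hφ₀ z hR) (spaceCut_nonneg hφ₀ z R)
    (integral_spaceCut_pos hφ₀ z hR) hvI hgI
    (fun φ hφ => by
      have := hg.2.2 φ hφ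
      rw [pow_one, neg_one_mul] at this
      exact this)
  rw [← integral_spaceCut_eq hφ₀ z hR] at this
  exact this

/-- The energy bound for approximate temporal cut-offs. -/
lemma exists_energy_bound (hφ₀ : IsSpaceCutoff φ₀) (hχ₀ : IsTimeCutoff χ₀) :
    ∃ K : ℝ, 0 ≤ K ∧ ∀ (z : ℝ × ℝ) (R : ℝ), 0 < R → ∀ v g h : ℝ × ℝ → ℝ,
      HasWeakDx 1 z R v g → MemLpq 2 ⊤ z R v →
      (∀ φ : ℝ × ℝ → ℝ, IsTest (openCyl z R) φ →
        ∫ p in openCyl z R, (v p * (dt φ p - dx 4 φ p) - g p ^ 2 * dx 2 φ p) = 0) →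
      (∀ φ : ℝ × ℝ → ℝ, IsCylTest z R φ → (∀ p ∈ cyl z R, 0 ≤ φ p) →
        ∀ᵐ t ∂(volume.restrict (timeI z R)),
          1 / 2 * (∫ x in spaceI z R, v (x, t) ^ 2 * φ (x, t)) +
              (∫ p in spaceI z R ×ˢ Ioo (z.2 - R ^ 4) t, h p ^ 2 * φ p) ≤
            ∫ p in spaceI z R ×ˢ Ioo (z.2 - R ^ 4) t,
              (1 / 2 * (dt φ p - dx 4 φ p) * v p ^ 2 + 2 * g p ^ 2 * dx 2 φ p
                - 5 / 3 * g p ^ 3 * dx 1 φ p - g p ^ 2 * v p * dx 2 φ p)) →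
      IntegrableOn (fun p => g p ^ 2) (openCyl z R) →
      IntegrableOn (fun p => |g p| ^ 3) (openCyl z R) →
      ∀ ε > 0, ∀ᵐ t ∂(volume.restrict (timeI z R)),
        1 / 2 * (shiftedTimeCut χ₀ z R ε t *
            ∫ x in spaceI z R, hat φ₀ z R v (x, t) ^ 2 * spaceCut φ₀ z R x) +
          (∫ p in spaceI z R ×ˢ Ioo (z.2 - R ^ 4) t,
            h p ^ 2 * (shiftedTimeCut χ₀ z R ε p.2 * spaceCut φ₀ z R p.1)) ≤
        6 * K / R ^ 2 * (∫ p in openCyl z R, g p ^ 2) +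
          6 * K / R * ∫ p in openCyl z R, |g p| ^ 3 := by
  obtain ⟨Kχ, hKχ, hχ1, hχ2⟩ := hχ₀.exists_bound
  have hb := fun k => exists_bound_iteratedDeriv hφ₀.1 hφ₀.2.1 k
  choose D hD using hb
  have hD0 : ∀ k, 0 ≤ D k := fun k => (norm_nonneg _).trans (hD k 0)
  -- One constant dominating the derivatives of `φ₀` of all orders that occur in the energy
  -- inequality.
  set S := D 0 + D 1 + D 2 + D 4 with hS
  have hS0 : 0 ≤ S := by have := hD0 0; have := hD0 1; have := hD0 2; have := hD0 4; linarith
  refine ⟨Kχ * S, mul_nonneg hKχ hS0, ?_⟩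
  intro z R hR v g h hvg hv heq hen hg2 hg3 ε hε
  have hgm : AEStronglyMeasurable g (volume.restrict (openCyl z R)) :=
    hvg.2.1.aestronglyMeasurable
  have hgI : IntegrableOn g (openCyl z R) :=
    ((memLp_two_iff_integrable_sq hgm).2 hg2).integrable (by norm_num)
  have hw := ae_abs_hat_le hφ₀ hR hv hvg hgI
  have hg3' : IntegrableOn (fun p => g p ^ 3) (openCyl z R) := by
    refine (integrable_norm_iff (hgm.pow 3)).1 (hg3.congr (Filter.Eventually.of_forall fun p => ?_))
    simp
  have hwm : AEStronglyMeasurable (hat φ₀ z R v) (volume.restrict (openCyl z R)) :=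
    (hasWeakDx_hat (k := 0) hφ₀ hR hv hvg).1.aestronglyMeasurable
  -- Cubic integrability of `g` alone suffices, since the oscillation is dominated by the slice
  -- integral of `|g|`.
  have hgw : IntegrableOn (fun p => g p ^ 2 * hat φ₀ z R v p) (openCyl z R) := by
    refine ((integrableOn_slice_integral hg3).add (hg3.const_mul (2 * R))).mono'
      ((hgm.pow 2).mul hwm) ?_
    filter_upwards [ae_oscillation_bounds hR hgI hg2 hg3 hw] with p hp
    rw [norm_mul, norm_pow, Real.norm_eq_abs, Real.norm_eq_abs, sq_abs]
    exact hp.2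
  have key := ae_hat_energy_le (h := h) hR hv hg2 hg3' heq hen (contDiff_spaceCut hφ₀ z R)
    (hasCompactSupport_spaceCut hφ₀ z hR) (tsupport_spaceCut_subset hφ₀ z hR)
    (spaceCut_nonneg hφ₀ z R) (integral_spaceCut_pos hφ₀ z hR)
    (m := fun t => wmean φ₀ z R fun x => v (x, t))
    (fun t => by rw [wmean, integral_spaceCut_eq hφ₀ z hR]) hgw
    (contDiff_shiftedTimeCut hχ₀ z R ε) (hasCompactSupport_shiftedTimeCut hχ₀ z hR)
    (tsupport_shiftedTimeCut_subset hχ₀ z hR hε) (shiftedTimeCut_nonneg hχ₀ z R ε)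
  have bk : ∀ k, D k ≤ S → ∀ x, |iteratedDeriv k (spaceCut φ₀ z R) x| ≤ S / R ^ k := by
    intro k hk x
    rw [iteratedDeriv_spaceCut hφ₀, abs_mul, abs_of_pos (inv_pos.2 (pow_pos hR k)),
      div_eq_inv_mul S]
    exact mul_le_mul_of_nonneg_left ((hD k _).trans hk) (inv_pos.2 (pow_pos hR k)).le
  have bθ : ∀ t, t < z.2 → |shiftedTimeCut χ₀ z R ε t| ≤ Kχ := fun t ht => by
    rw [shiftedTimeCut_eq z hR ht]; exact hχ1 _
  have prod : ∀ k, D k ≤ S → ∀ p ∈ openCyl z R,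
      |shiftedTimeCut χ₀ z R ε p.2 * iteratedDeriv k (spaceCut φ₀ z R) p.1| ≤
        Kχ * S / R ^ k := by
    intro k hk p hp
    rw [abs_mul, mul_div_assoc]
    exact mul_le_mul (bθ _ hp.2.2) (bk k hk _) (abs_nonneg _) hKχ
  have d0 := hD0 0
  have d1 := hD0 1
  have d2 := hD0 2
  have d4 := hD0 4
  filter_upwards [key, self_mem_ae_restrict measurableSet_Ioo] with t ht htI
  refine ht.trans ?_
  refine abs_energy_integral_le (w := hat φ₀ z R v) hR (mul_nonneg hKχ hS0) hgI hg2 hg3 hw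
    (b0 := fun p => deriv (shiftedTimeCut χ₀ z R ε) p.2 * spaceCut φ₀ z R p.1)
    (b1 := fun p => shiftedTimeCut χ₀ z R ε p.2 * iteratedDeriv 1 (spaceCut φ₀ z R) p.1)
    (b2 := fun p => shiftedTimeCut χ₀ z R ε p.2 * iteratedDeriv 2 (spaceCut φ₀ z R) p.1)
    (b4 := fun p => shiftedTimeCut χ₀ z R ε p.2 * iteratedDeriv 4 (spaceCut φ₀ z R) p.1)
    ?_ ?_ (prod 2 (by linarith)) (prod 4 (by linarith)) htI
  · intro p hp
    have h1 := bk 0 (by linarith) p.1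
    rw [iteratedDeriv_zero, pow_zero, div_one] at h1
    rw [deriv_shiftedTimeCut_eq hχ₀ z hR hp.2.2, abs_mul, abs_mul,
      abs_of_pos (inv_pos.2 (pow_pos hR 4)), mul_right_comm, ← div_eq_mul_inv]
    gcongr
    exact hχ2 _
  · intro p hp
    have := prod 1 (by linarith) p hp
    rwa [pow_one] at this

end Main

/-! ### Removing the shift of the temporal cut-off -/

section Limit

open Filter Topology

variable {φ₀ χ₀ : ℝ → ℝ} {z : ℝ × ℝ} {R B : ℝ} {v h : ℝ × ℝ → ℝ}

lemma ae_memLp_slice (hv : MemLpq 2 ⊤ z R v) : ∀ᵐ t ∂(volume.restrict (timeI z R)),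
    MemLp (fun x => v (x, t)) 2 (volume.restrict (spaceI z R)) := by
  obtain ⟨C, hC, hb⟩ := hv.ae_le
  have hm := hv.1
  rw [volume_restrict_openCyl] at hm
  filter_upwards [hb, hm.prodMk_right] with t ht hmt
  exact ⟨hmt, (ENNReal.pow_lt_top_iff.1 (ht.trans_lt hC)).resolve_right (by norm_num)⟩

lemma memLp_hat_slice {t : ℝ} (hvt : MemLp (fun x => v (x, t)) 2 (volume.restrict (spaceI z R))) :
    MemLp (fun x => hat φ₀ z R v (x, t)) 2 (volume.restrict (spaceI z R)) :=
  hvt.sub (memLp_const (wmean φ₀ z R fun x => v (x, t)))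

lemma integrableOn_hat_sq_slice (hφ₀ : IsSpaceCutoff φ₀) (hR : 0 < R) {t : ℝ}
    (hvt : MemLp (fun x => v (x, t)) 2 (volume.restrict (spaceI z R))) :
    IntegrableOn (fun x => hat φ₀ z R v (x, t) ^ 2 * spaceCut φ₀ z R x) (spaceI z R) := by
  obtain ⟨D, hD⟩ := (hasCompactSupport_spaceCut hφ₀ z hR).exists_bound_of_continuous
    (contDiff_spaceCut hφ₀ z R).continuous
  exact (memLp_hat_slice hvt).integrable_sq.mul_bdd
    (contDiff_spaceCut hφ₀ z R).continuous.aestronglyMeasurable (Eventually.of_forall hD)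

lemma lintegral_hat_slice (hφ₀ : IsSpaceCutoff φ₀) (hχ₀ : IsTimeCutoff χ₀) (hR : 0 < R) {t : ℝ}
    (hvt : MemLp (fun x => v (x, t)) 2 (volume.restrict (spaceI z R))) :
    ∫⁻ x in spaceI z R, ENNReal.ofReal (|hat φ₀ z R v (x, t)| ^ 2 * eta φ₀ χ₀ z R (x, t)) =
      ENNReal.ofReal (timeCut χ₀ z R t *
        ∫ x in spaceI z R, hat φ₀ z R v (x, t) ^ 2 * spaceCut φ₀ z R x) := by
  have e : ∀ x, |hat φ₀ z R v (x, t)| ^ 2 * eta φ₀ χ₀ z R (x, t) =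
      timeCut χ₀ z R t * (hat φ₀ z R v (x, t) ^ 2 * spaceCut φ₀ z R x) := by
    intro x
    rw [sq_abs, eta]
    ring
  simp only [e]
  rw [← integral_const_mul, ofReal_integral_eq_lintegral_ofReal
    ((integrableOn_hat_sq_slice hφ₀ hR hvt).const_mul _)]
  exact Eventually.of_forall fun x => mul_nonneg (hχ₀.2.1 _)
    (mul_nonneg (sq_nonneg _) (spaceCut_nonneg hφ₀ z R x))

/-- Because of this orthogonality to constants, `v` and its oscillation have the same pairing with
the function `W` in `le_of_weaklyContinuous`, so weak continuity of `v` is enough there. -/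
lemma integral_hat_mul_spaceCut (hφ₀ : IsSpaceCutoff φ₀) (hR : 0 < R) {t : ℝ}
    (hvt : MemLp (fun x => v (x, t)) 2 (volume.restrict (spaceI z R))) :
    ∫ x in spaceI z R, hat φ₀ z R v (x, t) * spaceCut φ₀ z R x = 0 := by
  obtain ⟨D, hD⟩ := (hasCompactSupport_spaceCut hφ₀ z hR).exists_bound_of_continuous
    (contDiff_spaceCut hφ₀ z R).continuous
  have ca := (contDiff_spaceCut hφ₀ z R).continuous
  have i1 : Integrable (fun x => v (x, t) * spaceCut φ₀ z R x)
      (volume.restrict (spaceI z R)) :=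
    (hvt.integrable (by norm_num)).mul_bdd ca.aestronglyMeasurable (Eventually.of_forall hD)
  have i2 : IntegrableOn (spaceCut φ₀ z R) (spaceI z R) :=
    (ca.integrable_of_hasCompactSupport (hasCompactSupport_spaceCut hφ₀ z hR)).integrableOn
  simp only [hat, sub_mul]
  rw [integral_sub i1 (i2.const_mul _), integral_const_mul, wmean, mul_assoc, inv_mul_cancel₀,
    mul_one, sub_self]
  rw [integral_spaceCut_eq hφ₀ z hR]
  exact (integral_spaceCut_pos hφ₀ z hR).ne'

/-- Energy bounds which hold for the approximate temporal cut-offs. -/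
def ApproxEnergyBound (φ₀ χ₀ : ℝ → ℝ) (z : ℝ × ℝ) (R : ℝ) (v h : ℝ × ℝ → ℝ) (B : ℝ) : Prop :=
  ∀ ε > 0, ∀ᵐ t ∂(volume.restrict (timeI z R)),
    1 / 2 * (shiftedTimeCut χ₀ z R ε t *
        ∫ x in spaceI z R, hat φ₀ z R v (x, t) ^ 2 * spaceCut φ₀ z R x) +
      (∫ p in spaceI z R ×ˢ Ioo (z.2 - R ^ 4) t,
        h p ^ 2 * (shiftedTimeCut χ₀ z R ε p.2 * spaceCut φ₀ z R p.1)) ≤ B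

/-- Countably many shifts `1 / (n + 1)` share one exceptional null set. Both energy terms are
nonnegative, so each is bounded separately; the shift is removed here only in the slice term. -/
lemma ApproxEnergyBound.ae_le (hφ₀ : IsSpaceCutoff φ₀) (hχ₀ : IsTimeCutoff χ₀) (hR : 0 < R)
    (hE : ApproxEnergyBound φ₀ χ₀ z R v h B) :
    ∀ᵐ t ∂(volume.restrict (timeI z R)), timeCut χ₀ z R t *
        (∫ x in spaceI z R, hat φ₀ z R v (x, t) ^ 2 * spaceCut φ₀ z R x) ≤ 2 * B ∧
      ∀ n : ℕ, ∫ p in spaceI z R ×ˢ Ioo (z.2 - R ^ 4) t, h p ^ 2 *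
        (shiftedTimeCut χ₀ z R (1 / ((n : ℝ) + 1)) p.2 * spaceCut φ₀ z R p.1) ≤ B := by
  have hall := ae_all_iff.2 fun n : ℕ => hE (1 / ((n : ℝ) + 1)) (by positivity)
  filter_upwards [hall, self_mem_ae_restrict measurableSet_Ioo] with t ht htI
  have X0 : 0 ≤ ∫ x in spaceI z R, hat φ₀ z R v (x, t) ^ 2 * spaceCut φ₀ z R x :=
    integral_nonneg fun x => mul_nonneg (sq_nonneg _) (spaceCut_nonneg hφ₀ z R x)
  have H0 : ∀ n : ℕ, 0 ≤ ∫ p in spaceI z R ×ˢ Ioo (z.2 - R ^ 4) t, h p ^ 2 *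
        (shiftedTimeCut χ₀ z R (1 / ((n : ℝ) + 1)) p.2 * spaceCut φ₀ z R p.1) := fun n =>
    integral_nonneg fun p => mul_nonneg (sq_nonneg _)
      (mul_nonneg (shiftedTimeCut_nonneg hχ₀ z R _ _) (spaceCut_nonneg hφ₀ z R _))
  constructor
  · refine le_of_tendsto ((tendsto_shiftedTimeCut hχ₀ z hR htI.2).mul_const _)
      (Eventually.of_forall fun n => ?_)
    have := ht n
    have := H0 n
    linarith
  · intro n
    have := ht n
    have := mul_nonneg (shiftedTimeCut_nonneg hχ₀ z R (1 / ((n : ℝ) + 1)) t) X0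
    linarith

/-- Fatou's lemma, with the upper time limit tending to the final time and the shift tending to zero
along the same index. -/
lemma ApproxEnergyBound.lintegral_le (hφ₀ : IsSpaceCutoff φ₀) (hχ₀ : IsTimeCutoff χ₀)
    (hR : 0 < R) (hh : MemLp h 2 (volume.restrict (openCyl z R)))
    (hE : ApproxEnergyBound φ₀ χ₀ z R v h B) :
    ∫⁻ p in openCyl z R, ENNReal.ofReal (|h p| ^ 2 * eta φ₀ χ₀ z R p) ≤ ENNReal.ofReal B := by
  have hστ : z.2 - R ^ 4 < z.2 := by linarith [pow_pos hR 4]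
  obtain ⟨u, hu, hlim⟩ := exists_seq_tendsto_of_ae hστ (right_mem_Icc.2 hστ.le)
    (hE.ae_le hφ₀ hχ₀ hR)
  set H : ℕ → ℝ × ℝ → ℝ := fun n p => h p ^ 2 *
    (shiftedTimeCut χ₀ z R (1 / ((n : ℝ) + 1)) p.2 * spaceCut φ₀ z R p.1) with hH
  have cθ : ∀ n : ℕ, Continuous (fun p : ℝ × ℝ =>
      shiftedTimeCut χ₀ z R (1 / ((n : ℝ) + 1)) p.2 * spaceCut φ₀ z R p.1) := fun n =>
    ((contDiff_shiftedTimeCut hχ₀ z R _).continuous.comp continuous_snd).mul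
      ((contDiff_spaceCut hφ₀ z R).continuous.comp continuous_fst)
  have hHI : ∀ n, IntegrableOn (H n) (openCyl z R) := by
    intro n
    have hT := isTest_mul (contDiff_spaceCut hφ₀ z R) (hasCompactSupport_spaceCut hφ₀ z hR)
      (Set.subset_univ _) (contDiff_shiftedTimeCut hχ₀ z R (1 / ((n : ℝ) + 1)))
      (hasCompactSupport_shiftedTimeCut hχ₀ z hR) (Set.subset_univ _)
    obtain ⟨D, hD⟩ := hT.2.1.exists_bound_of_continuous hT.1.continuous
    exact hh.integrable_sq.mul_bdd (cθ n).aestronglyMeasurable (Eventually.of_forall hD)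
  have hH0 : ∀ n p, 0 ≤ H n p := fun n p => mul_nonneg (sq_nonneg _)
    (mul_nonneg (shiftedTimeCut_nonneg hχ₀ z R _ _) (spaceCut_nonneg hφ₀ z R _))
  have hS : ∀ n, MeasurableSet {p : ℝ × ℝ | p.2 < u n} := fun n =>
    measurableSet_lt measurable_snd measurable_const
  set F : ℕ → ℝ × ℝ → ℝ≥0∞ := fun n =>
    {p : ℝ × ℝ | p.2 < u n}.indicator (fun p => ENNReal.ofReal (H n p)) with hF
  have hFle : ∀ n, ∫⁻ p in openCyl z R, F n p ≤ ENNReal.ofReal B := by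
    intro n
    rw [hF, lintegral_indicator (hS n), Measure.restrict_restrict (hS n)]
    have hset : {p : ℝ × ℝ | p.2 < u n} ∩ openCyl z R =
        spaceI z R ×ˢ Ioo (z.2 - R ^ 4) (u n) := by
      ext p
      simp only [mem_inter_iff, mem_ofPred_eq, openCyl, timeI, mem_prod, mem_Ioo]
      constructor
      · rintro ⟨h1, h2, h3, h4⟩
        exact ⟨h2, h3, h1⟩
      · rintro ⟨h2, h3, h1⟩
        exact ⟨h1, h2, h3, h1.trans (hu n).1.2⟩
    have hI : IntegrableOn (H n) (spaceI z R ×ˢ Ioo (z.2 - R ^ 4) (u n)) :=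
      (hHI n).mono_set (by rw [← hset]; exact inter_subset_right)
    rw [hset, ← ofReal_integral_eq_lintegral_ofReal hI (Eventually.of_forall (hH0 n))]
    exact ENNReal.ofReal_le_ofReal ((hu n).2.2 n)
  have hFm : ∀ n, AEMeasurable (F n) (volume.restrict (openCyl z R)) := fun n =>
    ((hHI n).aestronglyMeasurable.aemeasurable.ennreal_ofReal).indicator (hS n)
  calc ∫⁻ p in openCyl z R, ENNReal.ofReal (|h p| ^ 2 * eta φ₀ χ₀ z R p)
      ≤ ∫⁻ p in openCyl z R, liminf (fun n => F n p) atTop := by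
        refine setLIntegral_mono_ae' (isOpen_openCyl z R).measurableSet
          (Eventually.of_forall fun p hp => le_of_eq ?_)
        refine (Tendsto.liminf_eq ?_).symm
        have ev : ∀ᶠ n in atTop, ENNReal.ofReal (H n p) = F n p := by
          filter_upwards [hlim.eventually (lt_mem_nhds hp.2.2)] with n hn
          exact (indicator_of_mem (s := {p : ℝ × ℝ | p.2 < u n}) hn
            (fun p => ENNReal.ofReal (H n p))).symm
        refine Tendsto.congr' ev (ENNReal.tendsto_ofReal ?_)
        rw [sq_abs]
        exact ((tendsto_shiftedTimeCut hχ₀ z hR hp.2.2).mul_const _).const_mul _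
    _ ≤ liminf (fun n => ∫⁻ p in openCyl z R, F n p) atTop := lintegral_liminf_le' hFm
    _ ≤ ENNReal.ofReal B :=
        liminf_le_of_frequently_le' (Frequently.of_forall hFle)

/-- Lower semicontinuity of a weighted `L₂` norm under weak convergence: good times `u n` tend to
`s`, and `v (u n)` is paired with the fixed function `W`, the weighted oscillation at time `s`. -/
lemma ApproxEnergyBound.le_of_weaklyContinuous (hφ₀ : IsSpaceCutoff φ₀) (hχ₀ : IsTimeCutoff χ₀)
    (hR : 0 < R) (hw : IsWeaklyContinuous z R v) (hE : ApproxEnergyBound φ₀ χ₀ z R v h B)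
    {s : ℝ} (hs : s ∈ timeI z R) :
    timeCut χ₀ z R s *
      (∫ x in spaceI z R, hat φ₀ z R v (x, s) ^ 2 * spaceCut φ₀ z R x) ≤ 2 * B := by
  have hστ : z.2 - R ^ 4 < z.2 := by linarith [pow_pos hR 4]
  obtain ⟨u, hu, hlim⟩ := exists_seq_tendsto_of_ae hστ (Ioo_subset_Icc_self hs)
    (hE.ae_le hφ₀ hχ₀ hR)
  obtain ⟨D, hD⟩ := (hasCompactSupport_spaceCut hφ₀ z hR).exists_bound_of_continuous
    (contDiff_spaceCut hφ₀ z R).continuous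
  have ca := (contDiff_spaceCut hφ₀ z R).continuous
  set W : ℝ → ℝ := fun x => hat φ₀ z R v (x, s) * spaceCut φ₀ z R x with hW
  set X : ℝ → ℝ := fun t => ∫ x in spaceI z R, hat φ₀ z R v (x, t) ^ 2 * spaceCut φ₀ z R x with hX
  have hWL : MemLp W 2 (volume.restrict (spaceI z R)) :=
    (memLp_hat_slice (hw.1 s hs)).of_le_mul (c := D)
      ((memLp_hat_slice (hw.1 s hs)).1.mul ca.aestronglyMeasurable)
      (Eventually.of_forall fun x => by
        rw [norm_mul, mul_comm]
        exact mul_le_mul_of_nonneg_right (hD x) (norm_nonneg _))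
  have hW1 : Integrable W (volume.restrict (spaceI z R)) := hWL.integrable (by norm_num)
  have hpair : ∀ t ∈ timeI z R, ∫ x in spaceI z R, v (x, t) * W x =
      ∫ x in spaceI z R, hat φ₀ z R v (x, t) * W x := by
    intro t ht
    have i1 : Integrable (fun x => v (x, t) * W x) (volume.restrict (spaceI z R)) :=
      (hw.1 t ht).integrable_mul hWL
    simp only [hat, sub_mul]
    rw [integral_sub i1 (hW1.const_mul _), integral_const_mul, hW,
      integral_hat_mul_spaceCut hφ₀ hR (hw.1 s hs), mul_zero, sub_zero]
  have hlimY : Tendsto (fun n => ∫ x in spaceI z R, v (x, u n) * W x) atTop (𝓝 (X s)) := by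
    have hc := (hw.2 W hWL).continuousAt (Ioo_mem_nhds hs.1 hs.2)
    have := hc.tendsto.comp hlim
    rw [hpair s hs] at this
    refine this.congr' (Eventually.of_forall fun n => rfl) |>.trans (le_of_eq ?_)
    congr 1
    simp only [hX, hW]
    congr 1; ext x; ring
  have hχc : Tendsto (fun n => timeCut χ₀ z R (u n)) atTop (𝓝 (timeCut χ₀ z R s)) := by
    have : Continuous (timeCut χ₀ z R) :=
      hχ₀.1.continuous.comp ((continuous_id.sub continuous_const).div_const _)
    exact (this.tendsto s).comp hlim
  -- From `2 ab ≤ a² + b²` under the weighted integral. In the limit the left side becomes twice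
  -- `timeCut χ₀ z R s * X s`, one copy of which is absorbed.
  have hineq : ∀ n, 2 * (timeCut χ₀ z R (u n) * ∫ x in spaceI z R, v (x, u n) * W x) ≤
      2 * B + timeCut χ₀ z R (u n) * X s := by
    intro n
    have hun := (hu n).1
    have h1 : 2 * (∫ x in spaceI z R, v (x, u n) * W x) ≤ X (u n) + X s := by
      rw [hpair _ hun, hX, ← integral_const_mul]
      simp only
      rw [← integral_add (integrableOn_hat_sq_slice hφ₀ hR (hw.1 _ hun))
        (integrableOn_hat_sq_slice hφ₀ hR (hw.1 s hs))]
      refine integral_mono (((memLp_hat_slice (hw.1 _ hun)).integrable_mul hWL).const_mul 2)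
        ((integrableOn_hat_sq_slice hφ₀ hR (hw.1 _ hun)).add
          (integrableOn_hat_sq_slice hφ₀ hR (hw.1 s hs))) fun x => ?_
      simp only [hW]
      have := mul_nonneg (sq_nonneg (hat φ₀ z R v (x, u n) - hat φ₀ z R v (x, s)))
        (spaceCut_nonneg hφ₀ z R x)
      nlinarith
    have h2 : timeCut χ₀ z R (u n) * X (u n) ≤ 2 * B := (hu n).2.1
    have h3 := mul_le_mul_of_nonneg_left h1 (hχ₀.2.1 ((u n - z.2) / R ^ 4))
    change timeCut χ₀ z R (u n) * _ ≤ timeCut χ₀ z R (u n) * _ at h3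
    linarith
  have hfin := le_of_tendsto_of_tendsto' ((hχc.mul hlimY).const_mul 2)
    ((hχc.mul_const (X s)).const_add (2 * B)) hineq
  linarith

end Limit

/-! ### Assembly of the Caccioppoli inequality -/

/-- The Caccioppoli inequality with given weak derivatives `g`, `h` of `v`. -/
lemma exists_caccioppoli {φ₀ χ₀ : ℝ → ℝ} (hφ₀ : IsSpaceCutoff φ₀) (hχ₀ : IsTimeCutoff χ₀) :
    ∃ C : ℝ, 0 < C ∧ ∀ (z : ℝ × ℝ) (R : ℝ), 0 < R → ∀ v g h : ℝ × ℝ → ℝ,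
      HasWeakDx 1 z R v g → MemLpq 2 ⊤ z R v → MemLpq 2 2 z R h →
      (∀ φ : ℝ × ℝ → ℝ, IsTest (openCyl z R) φ →
        ∫ p in openCyl z R, (v p * (dt φ p - dx 4 φ p) - g p ^ 2 * dx 2 φ p) = 0) →
      (∀ φ : ℝ × ℝ → ℝ, IsCylTest z R φ → (∀ p ∈ cyl z R, 0 ≤ φ p) →
        ∀ᵐ t ∂(volume.restrict (timeI z R)),
          1 / 2 * (∫ x in spaceI z R, v (x, t) ^ 2 * φ (x, t)) +
              (∫ p in spaceI z R ×ˢ Ioo (z.2 - R ^ 4) t, h p ^ 2 * φ p) ≤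
            ∫ p in spaceI z R ×ˢ Ioo (z.2 - R ^ 4) t,
              (1 / 2 * (dt φ p - dx 4 φ p) * v p ^ 2 + 2 * g p ^ 2 * dx 2 φ p
                - 5 / 3 * g p ^ 3 * dx 1 φ p - g p ^ 2 * v p * dx 2 φ p)) →
      ∀ S : ℝ≥0∞,
        (S ≤ essSup (fun t => ∫⁻ x in spaceI z R,
            ENNReal.ofReal (|hat φ₀ z R v (x, t)| ^ 2 * eta φ₀ χ₀ z R (x, t)))
            (volume.restrict (timeI z R)) ∨
          IsWeaklyContinuous z R v ∧ S ≤ ⨆ t ∈ timeI z R, ∫⁻ x in spaceI z R,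
            ENNReal.ofReal (|hat φ₀ z R v (x, t)| ^ 2 * eta φ₀ χ₀ z R (x, t))) →
        S + (∫⁻ p in openCyl z R, ENNReal.ofReal (|h p| ^ 2 * eta φ₀ χ₀ z R p)) ≤
          ENNReal.ofReal (C / R ^ 2) * (∫⁻ p in openCyl z R, ENNReal.ofReal (|g p| ^ 2)) +
            ENNReal.ofReal (C / R) * (∫⁻ p in openCyl z R, ENNReal.ofReal (|g p| ^ 3)) := by
  obtain ⟨K, hK, H⟩ := exists_energy_bound hφ₀ hχ₀
  -- The slice term is at most `2 B` and the second-derivative term at most `B`, with `B` carrying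
  -- the factor `6 K`. The summand `1` keeps the constant positive even if `K = 0`.
  refine ⟨18 * K + 1, by positivity, ?_⟩
  intro z R hR v g h hvg hv hh heq hen S hS
  have hgm : AEStronglyMeasurable g (volume.restrict (openCyl z R)) :=
    hvg.2.1.aestronglyMeasurable
  have m2 : AEStronglyMeasurable (fun p => |g p| ^ 2) (volume.restrict (openCyl z R)) :=
    hgm.norm.pow 2
  have m3 : AEStronglyMeasurable (fun p => |g p| ^ 3) (volume.restrict (openCyl z R)) :=
    hgm.norm.pow 3
  -- If an integral on the right is infinite there is nothing to prove; otherwise finiteness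
  -- supplies the integrability of `g²` and `|g|³` that the energy bound requires.
  by_cases f2 : ∫⁻ p in openCyl z R, ENNReal.ofReal (|g p| ^ 2) = ⊤
  · rw [f2, ENNReal.mul_top (by simp only [ne_eq, ENNReal.ofReal_eq_zero, not_le]; positivity),
      top_add]
    exact le_top
  by_cases f3 : ∫⁻ p in openCyl z R, ENNReal.ofReal (|g p| ^ 3) = ⊤
  · rw [f3, ENNReal.mul_top (by simp only [ne_eq, ENNReal.ofReal_eq_zero, not_le]; positivity),
      add_top]
    exact le_top
  have p2 : ∀ p, 0 ≤ |g p| ^ 2 := fun p => by positivity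
  have p3 : ∀ p, 0 ≤ |g p| ^ 3 := fun p => by positivity
  have hg2 := (lintegral_ofReal_ne_top_iff_integrable m2 (Filter.Eventually.of_forall p2)).1 f2
  have hg3 := (lintegral_ofReal_ne_top_iff_integrable m3 (Filter.Eventually.of_forall p3)).1 f3
  rw [← ofReal_integral_eq_lintegral_ofReal hg2 (Filter.Eventually.of_forall p2),
    ← ofReal_integral_eq_lintegral_ofReal hg3 (Filter.Eventually.of_forall p3),
    ← ENNReal.ofReal_mul (by positivity), ← ENNReal.ofReal_mul (by positivity),
    ← ENNReal.ofReal_add (mul_nonneg (by positivity) (integral_nonneg p2))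
      (mul_nonneg (by positivity) (integral_nonneg p3))]
  have e2 : ∫ p in openCyl z R, |g p| ^ 2 = ∫ p in openCyl z R, g p ^ 2 := by simp only [sq_abs]
  have hg2' : IntegrableOn (fun p => g p ^ 2) (openCyl z R) := by
    have := hg2
    simp only [sq_abs] at this
    exact this
  set E2 := ∫ p in openCyl z R, |g p| ^ 2 with hE2
  set E3 := ∫ p in openCyl z R, |g p| ^ 3 with hE3
  have E2n : 0 ≤ E2 := integral_nonneg p2
  have E3n : 0 ≤ E3 := integral_nonneg p3
  set B := 6 * K / R ^ 2 * E2 + 6 * K / R * E3 with hB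
  have hB0 : 0 ≤ B := by positivity
  have hE : ApproxEnergyBound φ₀ χ₀ z R v h B := by
    have := H z R hR v g h hvg hv heq hen hg2' hg3
    rw [← e2] at this
    exact this
  -- The variable `S` lets the essential supremum and the supremum over every time share the rest of
  -- the argument.
  have hS2 : S ≤ ENNReal.ofReal (2 * B) := by
    rcases hS with hS | ⟨hw, hS⟩
    · refine hS.trans (essSup_le_of_ae_le _ ?_)
      filter_upwards [hE.ae_le hφ₀ hχ₀ hR, ae_memLp_slice hv] with t ht hvt
      rw [lintegral_hat_slice hφ₀ hχ₀ hR hvt]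
      exact ENNReal.ofReal_le_ofReal ht.1
    · refine hS.trans (iSup₂_le fun t ht => ?_)
      rw [lintegral_hat_slice hφ₀ hχ₀ hR (hw.1 t ht)]
      exact ENNReal.ofReal_le_ofReal (hE.le_of_weaklyContinuous hφ₀ hχ₀ hR hw ht)
  refine (add_le_add hS2 (hE.lintegral_le hφ₀ hχ₀ hR hh.memLp_two)).trans ?_
  rw [← ENNReal.ofReal_add (by positivity) hB0]
  refine ENNReal.ofReal_le_ofReal ?_
  have : 2 * B + B = 18 * K / R ^ 2 * E2 + 18 * K / R * E3 := by rw [hB]; ring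
  rw [this]
  gcongr <;> linarith

end SGM

theorem mainTheorem5 (φ₀ χ₀ : ℝ → ℝ) (hφ₀ : SGM.IsSpaceCutoff φ₀) (hχ₀ : SGM.IsTimeCutoff χ₀) :
    ∃ C : ℝ, 0 < C ∧ ∀ (z : ℝ × ℝ) (R : ℝ), 0 < R →
      ∀ v : ℝ × ℝ → ℝ, SGM.IsSuitableWeakSolution z R v →
        (∃ g : ℝ × ℝ → ℝ, SGM.HasWeakDx 1 z R (SGM.hat φ₀ z R v) g) ∧
        (∃ h : ℝ × ℝ → ℝ, SGM.HasWeakDx 2 z R (SGM.hat φ₀ z R v) h) ∧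
        ∀ g h : ℝ × ℝ → ℝ,
          SGM.HasWeakDx 1 z R (SGM.hat φ₀ z R v) g →
          SGM.HasWeakDx 2 z R (SGM.hat φ₀ z R v) h →
          (essSup (fun t => ∫⁻ x in SGM.spaceI z R,
                ENNReal.ofReal (|SGM.hat φ₀ z R v (x, t)| ^ 2 * SGM.eta φ₀ χ₀ z R (x, t)))
                (volume.restrict (SGM.timeI z R)) +
              (∫⁻ p in SGM.cyl z R, ENNReal.ofReal (|h p| ^ 2 * SGM.eta φ₀ χ₀ z R p)) ≤
            ENNReal.ofReal (C / R ^ 2) * (∫⁻ p in SGM.cyl z R, ENNReal.ofReal (|g p| ^ 2)) +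
              ENNReal.ofReal (C / R) * (∫⁻ p in SGM.cyl z R, ENNReal.ofReal (|g p| ^ 3))) ∧
          (SGM.IsWeaklyContinuous z R v →
            (⨆ t ∈ SGM.timeI z R, ∫⁻ x in SGM.spaceI z R,
                ENNReal.ofReal (|SGM.hat φ₀ z R v (x, t)| ^ 2 * SGM.eta φ₀ χ₀ z R (x, t))) +
              (∫⁻ p in SGM.cyl z R, ENNReal.ofReal (|h p| ^ 2 * SGM.eta φ₀ χ₀ z R p)) ≤
            ENNReal.ofReal (C / R ^ 2) * (∫⁻ p in SGM.cyl z R, ENNReal.ofReal (|g p| ^ 2)) +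
              ENNReal.ofReal (C / R) * (∫⁻ p in SGM.cyl z R, ENNReal.ofReal (|g p| ^ 3))) := by
  obtain ⟨C, hC, H⟩ := SGM.exists_caccioppoli hφ₀ hχ₀
  refine ⟨C, hC, fun z R hR v hv => ?_⟩
  obtain ⟨vx, vxx, hvx, hvxx, hvt, hvv, heq, hen⟩ := hv
  have hx := SGM.hasWeakDx_hat (k := 0) hφ₀ hR hvt hvx
  have hxx := SGM.hasWeakDx_hat (k := 1) hφ₀ hR hvt hvxx
  refine ⟨⟨vx, hx⟩, ⟨vxx, hxx⟩, fun g h hg hh => ?_⟩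
  have eg := hg.ae_eq hx
  have eh := hh.ae_eq hxx
  have key := H z R hR v vx vxx hvx hvt hvv heq hen
  have e1 : ∫⁻ p in SGM.openCyl z R, ENNReal.ofReal (|h p| ^ 2 * SGM.eta φ₀ χ₀ z R p) =
      ∫⁻ p in SGM.openCyl z R, ENNReal.ofReal (|vxx p| ^ 2 * SGM.eta φ₀ χ₀ z R p) :=
    lintegral_congr_ae (eh.mono fun p hp => by simp only [hp])
  have e2 : ∀ k : ℕ, ∫⁻ p in SGM.openCyl z R, ENNReal.ofReal (|g p| ^ k) =
      ∫⁻ p in SGM.openCyl z R, ENNReal.ofReal (|vx p| ^ k) := fun k =>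
    lintegral_congr_ae (eg.mono fun p hp => by simp only [hp])
  rw [SGM.volume_restrict_cyl, e1, e2, e2]
  exact ⟨key _ (Or.inl le_rfl), fun hw => key _ (Or.inr ⟨hw, le_rfl⟩)⟩
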